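/- Let $p$ be an odd prime and let $R$ be a regular local integral domain which is a finitely generated $\mathbf Z_p$-algebra, with field of fractions $K$. Let $n>2$, assume $\mu_n\subset R$ (i.e. $R$ contains a primitive $n$-th root of unity), and let $D=\langle\sigma,\tau\mid \sigma^n=\tau^2=1,\ \tau\sigma\tau=\sigma^{-1}\rangle$ be the dihedral group of order $2n$, $C=\langle\sigma\rangle$. For a character $\phi:C\to R^\times$ put $e_\phi=n^{-1}\sum_{\zeta\in C}\phi(\zeta)\zeta^{-1}\in K[C]$ and $\bar\phi=\phi^{-1}$. Let $\mathcal M=\bigoplus_\phi R\,e_\phi$ and let $H=\mathcal M\circ\langle\tau\rangle=\mathcal M\oplus\mathcal M\tau\subset K[D]$ be the twisted group ring, a Hopf order in $K[D]$. Let $A=\mathrm{Hom}_R(H,R)$ be the dual Hopf algebra. Let $B$ be a principal homogeneous space (PHS) for $A$ over $R$: a commutative finite flat $R$-algebra which is an $A$-comodule algebra via $\alpha_B:B\to B\otimes_R A$, with $B^A=\{b\mid\alpha_B(b)=b\otimes1\}=R$, such that $B\otimes_R B\to B\otimes_R A$, $x\otimes y\mapsto (x\otimes1)\alpha_B(y)$,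 is an isomorphism. Then $H=A^D$ (and so $D\subset H$) acts on $B$ by $h\cdot b=\sum\langle h,b_{(1)}\rangle b_{(0)}$. Let $\delta$ be a generator of the $R$-module $\{b\in B\mid\sigma b=b,\ \tau b=-b\}$. Let $\chi:C\to R^\times$ be a character of order $>2$ and let $\alpha\in B^\times$ satisfy $\sigma\alpha=\chi(\sigma)\alpha$; write $\alpha^\tau=\tau\cdot\alpha$. Assume that $n$ is a unit of $R$ or that $n$ has a square root $n^{1/2}$ in $R$. Put $c=1$ if $n\in R^\times$ and $c=n^{-1/2}$ otherwise, and $\theta^D=c^2\sum_{d\in D}d\in H$. Let $$M=R\,e_\chi\oplus R\,e_{\bar\chi}\tau\subset K[D],\qquad q(x,y)=\tfrac12\,tr(x\,\tau\,\bar y),$$ where $H$ acts on $M$ by left multiplication, $y\mapsto\bar y$ is the $K$-linear map with $\bar d=d^{-1}$ for $d\in D$, and $tr:K[D]\to K$ is the $K$-linear map with $tr(1)=2n$ and $tr(d)=0$ for $1\ne d\in D$. Let $H$ act diagonally on $cB\otimes_R M$ (where $cB\subset K\otimes_R B$), let $\varepsilon^D$ be the counit of $H$, and let $$\tilde M_B=(cB\otimes_R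 M)^A=\{z\in cB\otimes_R M\mid hz=\varepsilon^D(h)z\ \ \forall h\in H\}.$$ Then $a=\alpha\,\alpha^\tau$ and $\delta^2$ lie in $R^\times$, and the following hold. (i) $\tilde M_B$ is a free $R$-module with basis $$\varepsilon_1=c\alpha^\tau\otimes e_\chi+c\alpha\otimes e_{\bar\chi}\tau,\qquad \varepsilon_2=c\delta\alpha^\tau\otimes e_\chi-c\delta\alpha\otimes e_{\bar\chi}\tau .$$ (ii) One has $\tilde M_B=\theta^D(cB\otimes_R M)$, and there is a (unique) $R$-bilinear form $\tilde q_B=(Tr\otimes q)^A:\tilde M_B\times\tilde M_B\to R$ with $\tilde q_B(x,y)=(Tr\otimes q)(m,y)=(Tr\otimes q)(x,m')$ whenever $x=\theta^D m$, $y=\theta^D m'$ with $m,m'\in cB\otimes_R M$, where $Tr(b,b')=Tr_{K\otimes_R B/K}(bb')$. It satisfies $$\tilde q_B(\varepsilon_1,\varepsilon_1)=2a,\qquad \tilde q_B(\varepsilon_2,\varepsilon_2)=-2a\delta^2,\qquad \tilde q_B(\varepsilon_1,\varepsilon_2)=0 .$$ -/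

import Mathlib

open scoped TensorProduct
set_option linter.unusedSectionVars false

namespace DihedralTwist

section Dual
variable (R H : Type*) [CommRing R] [Ring H] [Bialgebra R H]

/-- The dual `A = Hom_R(H, R)` of a bialgebra `H`. Its product is the convolution product, i.e. the
transpose of the comultiplication of `H`; its unit is the counit of `H`. It is commutative as soon as
`H` is cocommutative. -/
abbrev DualAlg : Type _ := WithConv (H →ₗ[R] R)

/-- The comultiplication of `A = Hom_R(H, R)` for `H` finite free: the transpose
`Hom_R(H, R) → Hom_R(H ⊗ H, R)` of the multiplication of `H`, followed by the canonical isomorphism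
`Hom_R(H ⊗ H, R) ≃ Hom_R(H, R) ⊗ Hom_R(H, R)`. -/
noncomputable def dualComul [Module.Free R H] [Module.Finite R H] :
    DualAlg R H →ₗ[R] DualAlg R H ⊗[R] DualAlg R H :=
  TensorProduct.map (WithConv.linearEquiv R (H →ₗ[R] R)).symm.toLinearMap
      (WithConv.linearEquiv R (H →ₗ[R] R)).symm.toLinearMap ∘ₗ
    (TensorProduct.dualDistribEquiv R H H).symm.toLinearMap ∘ₗ
    (LinearMap.mul' R H).dualMap ∘ₗ (WithConv.linearEquiv R (H →ₗ[R] R)).toLinearMap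

/-- The counit of `A = Hom_R(H, R)`: evaluation at `1`. -/
noncomputable def dualCounit : DualAlg R H →ₗ[R] R :=
  LinearMap.applyₗ (1 : H) ∘ₗ (WithConv.linearEquiv R (H →ₗ[R] R)).toLinearMap

/-- The pairing `⟨h, a⟩ = a(h)` between `H` and `A = Hom_R(H, R)`. -/
noncomputable def dualPairing : H →ₗ[R] DualAlg R H →ₗ[R] R :=
  (WithConv.linearEquiv R (H →ₗ[R] R)).toLinearMap.flip

theorem dualPairing_apply (h : H) (a : DualAlg R H) : dualPairing R H h a = a h := rfl

/-- The comultiplication of `A` is dual to the product of `H`: `⟨h ⊗ h', Δ a⟩ = a(h h')`. -/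
theorem dualComul_pairing [Module.Free R H] [Module.Finite R H] (a : DualAlg R H) (h h' : H) :
    LinearMap.mul' R R (TensorProduct.map (dualPairing R H h) (dualPairing R H h')
      (dualComul R H a)) = a (h * h') := by
  have key : ∀ t : Module.Dual R H ⊗[R] Module.Dual R H,
      LinearMap.mul' R R (TensorProduct.map (dualPairing R H h) (dualPairing R H h')
        (TensorProduct.map (WithConv.linearEquiv R (H →ₗ[R] R)).symm.toLinearMap
          (WithConv.linearEquiv R (H →ₗ[R] R)).symm.toLinearMap t)) =
        TensorProduct.dualDistribEquiv R H H t (h ⊗ₜ h') := by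
    intro t
    induction t with
    | zero => simp
    | add x y hx hy => simp only [map_add, hx, hy, LinearMap.add_apply]
    | tmul x y => simp [dualPairing_apply]
  simp only [dualComul, LinearMap.comp_apply, LinearEquiv.coe_coe]
  rw [key, LinearEquiv.apply_symm_apply]
  simp

end Dual

section Torsor
variable (R H : Type*) [CommRing R] [Ring H] [Bialgebra R H] [Coalgebra.IsCocomm R H]
  [Module.Free R H] [Module.Finite R H] {B : Type*} [CommRing B] [Algebra R B]

/-- `α : B → B ⊗ A` makes the algebra `B` a right comodule algebra over `A = Hom_R(H, R)`. -/
structure IsComoduleAlgebra (α : B →ₐ[R] B ⊗[R] DualAlg R H) : Prop where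
  coassoc : (TensorProduct.assoc R B (DualAlg R H) (DualAlg R H)).toLinearMap ∘ₗ
      α.toLinearMap.rTensor (DualAlg R H) ∘ₗ α.toLinearMap =
    (dualComul R H).lTensor B ∘ₗ α.toLinearMap
  counit : (TensorProduct.rid R B).toLinearMap ∘ₗ (dualCounit R H).lTensor B ∘ₗ α.toLinearMap =
    LinearMap.id

/-- The map `(id ⊗ 1, α) : B ⊗ B → B ⊗ A`, `x ⊗ y ↦ (x ⊗ 1) α(y)`. -/
noncomputable def torsorMap (α : B →ₐ[R] B ⊗[R] DualAlg R H) : B ⊗[R] B →ₐ[R] B ⊗[R] DualAlg R H :=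
  Algebra.TensorProduct.lift Algebra.TensorProduct.includeLeft α fun x y =>
    mul_comm (x ⊗ₜ[R] (1 : DualAlg R H)) (α y)

/-- `B`, with the coaction `α : B → B ⊗ A`, is a principal homogeneous space (PHS) for
`A = Hom_R(H, R)` over `R`: `B` is a finite flat comodule algebra, `B^A = {b | α(b) = b ⊗ 1}` is the
base ring `R` (which embeds in `B`), and `(id ⊗ 1, α) : B ⊗ B → B ⊗ A` is an isomorphism. (For a
comodule algebra that map automatically is `B`-linear, multiplicative and `H`-linear.) -/
structure IsPHS (α : B →ₐ[R] B ⊗[R] DualAlg R H) : Prop extends IsComoduleAlgebra R H α where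
  finite : Module.Finite R B
  flat : Module.Flat R B
  algebraMap_injective : Function.Injective (algebraMap R B)
  fixed_iff : ∀ b : B, α b = b ⊗ₜ[R] 1 ↔ b ∈ Set.range (algebraMap R B)
  bijective : Function.Bijective (torsorMap R H α)

variable {R H}

/-- The left action of `H = A^D` on `B` coming from the coaction: `h • b = ∑ ⟨h, b₍₁₎⟩ b₍₀₎`. -/
noncomputable def dualAct (α : B →ₐ[R] B ⊗[R] DualAlg R H) : H →ₗ[R] Module.End R B where
  toFun h := (TensorProduct.rid R B).toLinearMap ∘ₗ (dualPairing R H h).lTensor B ∘ₗ α.toLinearMap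
  map_add' h h' := by
    rw [map_add, LinearMap.lTensor_add, LinearMap.add_comp, LinearMap.comp_add]
  map_smul' r h := by
    rw [map_smul, LinearMap.lTensor_smul, LinearMap.smul_comp, LinearMap.comp_smul]; rfl

end Torsor

section Fixed
variable {R H V W : Type*} [CommRing R] [Ring H] [Bialgebra R H] [AddCommMonoid V] [Module R V]
  [AddCommMonoid W] [Module R W]

/-- The diagonal action of `H` on `V ⊗ W`: `h (v ⊗ w) = ∑ h₍₀₎ v ⊗ h₍₁₎ w`. -/
noncomputable def diagAct (ρ : H →ₗ[R] Module.End R V) (π : H →ₗ[R] Module.End R W) :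
    H →ₗ[R] Module.End R (V ⊗[R] W) :=
  TensorProduct.homTensorHomMap (RingHom.id R) V W V W ∘ₗ TensorProduct.map ρ π ∘ₗ Coalgebra.comul

/-- The fixed module `V^A = {z | h z = ε(h) z for all h ∈ H = A^D}`. -/
def fixedModule (ρ : H →ₗ[R] Module.End R V) : Submodule R V where
  carrier := {z | ∀ h : H, ρ h z = Coalgebra.counit (R := R) h • z}
  add_mem' {a b} ha hb h := by rw [map_add, ha h, hb h, smul_add]
  zero_mem' h := by simp
  smul_mem' r z hz h := by rw [map_smul, hz h, smul_comm]

variable {K : Type*} [Field K] [Algebra R K]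

/-- `β` is the form `Q^A` induced on the fixed module `V^A` by an equivariant form `Q` on `V`, with
respect to the integral `θ` of `H = A^D`: one has `V^A = θ V`, and `Q^A(x, y) = Q(m, y) = Q(x, m')`
whenever `x = θ m` and `y = θ m'`. (The values of `Q` are in `K`, those of `β` in `R`.) -/
structure IsInducedForm (ρ : H →ₗ[R] Module.End R V) (Q : V →ₗ[R] V →ₗ[R] K) (θ : H)
    (β : LinearMap.BilinForm R (fixedModule ρ)) : Prop where
  surjective : ∀ x : fixedModule ρ, ∃ m : V, ρ θ m = x
  left : ∀ (x y : fixedModule ρ) (m : V), ρ θ m = x → algebraMap R K (β x y) = Q m y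
  right : ∀ (x y : fixedModule ρ) (m : V), ρ θ m = y → algebraMap R K (β x y) = Q x m

/-- The induced form is unique. -/
theorem IsInducedForm.unique [IsDomain R] [IsFractionRing R K] {ρ : H →ₗ[R] Module.End R V}
    {Q : V →ₗ[R] V →ₗ[R] K} {θ : H} {β β' : LinearMap.BilinForm R (fixedModule ρ)}
    (h : IsInducedForm ρ Q θ β) (h' : IsInducedForm ρ Q θ β') : β = β' := by
  refine LinearMap.ext₂ fun x y => IsFractionRing.injective R K ?_
  obtain ⟨m, hm⟩ := h.surjective x
  rw [h.left x y m hm, h'.left x y m hm]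

end Fixed

section Lattice
variable {R : Type*} (K : Type*) {H B : Type*} [CommRing R] [Field K] [Algebra R K] [CommRing B]
  [Algebra R B]

/-- The lattice `c B` in `B_K = K ⊗_R B`, for `c ∈ K`. -/
noncomputable def scaledLattice (R : Type*) (K : Type*) (B : Type*) [CommRing R] [Field K] [Algebra R K]
    [CommRing B] [Algebra R B] (c : K) : Submodule R (K ⊗[R] B) :=
  LinearMap.range (TensorProduct.mk R K B c)

/-- The element `c b` of the lattice `c B`. -/
noncomputable def scaledElt (R : Type*) {B : Type*} [CommRing R] [Algebra R K] [CommRing B]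
    [Algebra R B] (c : K) (b : B) : scaledLattice R K B c :=
  ⟨c ⊗ₜ[R] b, b, rfl⟩

/-- The action of `H` on `c B`, restricted from its `K`-linear action on `B_K`. -/
noncomputable def scaledAct [Ring H] [Algebra R H] (ρ : H →ₗ[R] Module.End R B) (c : K) :
    H →ₗ[R] Module.End R (scaledLattice R K B c) where
  toFun h := (((ρ h).baseChange K).restrictScalars R).restrict (by
    rintro _ ⟨b, rfl⟩
    exact ⟨ρ h b, by simp⟩)
  map_add' h h' := by
    ext x
    simp [LinearMap.baseChange_add]
  map_smul' r h := by
    ext x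
    simp [LinearMap.baseChange_smul]

/-- The trace form `(x, y) ↦ Tr_{B_K/K}(x y)` on the lattice `c B`. -/
noncomputable def scaledTrace (R : Type*) (K : Type*) (B : Type*) [CommRing R] [Field K] [Algebra R K]
    [CommRing B] [Algebra R B] (c : K) :
    scaledLattice R K B c →ₗ[R] scaledLattice R K B c →ₗ[R] K :=
  ((Algebra.traceForm K (K ⊗[R] B)).restrictScalars₁₂ R R).domRestrict₁₂ _ _

/-- The tensor product `T ⊗ Q` of two `K`-valued bilinear forms:
`(T ⊗ Q)(v ⊗ w, v' ⊗ w') = T(v, v') Q(w, w')`. -/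
noncomputable def tensorForm {V W : Type*} [AddCommMonoid V] [Module R V] [AddCommMonoid W]
    [Module R W] (T : V →ₗ[R] V →ₗ[R] K) (Q : W →ₗ[R] W →ₗ[R] K) :
    V ⊗[R] W →ₗ[R] V ⊗[R] W →ₗ[R] K :=
  (LinearMap.BilinMap.tmul T Q).compr₂ (LinearMap.mul' R K)

theorem tensorForm_tmul {V W : Type*} [AddCommMonoid V] [Module R V] [AddCommMonoid W]
    [Module R W] (T : V →ₗ[R] V →ₗ[R] K) (Q : W →ₗ[R] W →ₗ[R] K) (v v' : V) (w w' : W) :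
    tensorForm K T Q (v ⊗ₜ w) (v' ⊗ₜ w') = T v v' * Q w w' := rfl

end Lattice

section Characters
variable {R : Type*} [CommRing R] [IsDomain R] {n : ℕ} [NeZero n]

instance finiteChar : Finite (AddChar (ZMod n) R) := by
  let f : AddChar (ZMod n) R → rootsOfUnity n R := fun φ =>
    rootsOfUnity.mkOfPowEq (φ 1) (by
      rw [← AddChar.map_nsmul_eq_pow]; simp)
  refine Finite.of_injective f ?_
  intro φ ψ h
  have h1 : φ 1 = ψ 1 := by
    have := congrArg (fun u : rootsOfUnity n R => ((u : Rˣ) : R)) h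
    simpa [f] using this
  ext x
  have hx : x = (x.val) • (1 : ZMod n) := by simp
  rw [hx, AddChar.map_nsmul_eq_pow, AddChar.map_nsmul_eq_pow, h1]

noncomputable instance fintypeChar : Fintype (AddChar (ZMod n) R) := Fintype.ofFinite _

variable [HasEnoughRootsOfUnity R n]

/-- A ring with `μ_n ⊂ R` has exactly `n` characters of the cyclic group of order `n`. -/
theorem card_char : Fintype.card (AddChar (ZMod n) R) = n := by
  have hE : Monoid.exponent (Multiplicative (ZMod n)) = n := by
    rw [IsCyclic.exponent_eq_card]; simp
  have : HasEnoughRootsOfUnity R (Monoid.exponent (Multiplicative (ZMod n))) := by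
    rw [hE]; infer_instance
  have h := CommGroup.card_monoidHom_of_hasEnoughRootsOfUnity (Multiplicative (ZMod n)) R
  rw [← Nat.card_eq_fintype_card]
  have e : AddChar (ZMod n) R ≃ (Multiplicative (ZMod n) →* Rˣ) :=
    AddChar.toMonoidHomEquiv.trans
      { toFun := fun f => f.toHomUnits
        invFun := fun f => (Units.coeHom R).comp f
        left_inv := fun f => by ext; simp
        right_inv := fun f => by ext; simp }
  rw [Nat.card_congr e, h]; simp

theorem sum_char (j : ZMod n) :
    ∑ φ : AddChar (ZMod n) R, φ j = if j = 0 then (n : R) else 0 := by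
  split_ifs with hj
  · subst hj; simp [card_char]
  · obtain ⟨f, hf⟩ := ZMod.exists_monoidHom_apply_ne_one
      (HasEnoughRootsOfUnity.exists_primitiveRoot R n) hj
    let φ₀ : AddChar (ZMod n) R := AddChar.toMonoidHomEquiv.symm ((Units.coeHom R).comp f)
    have h0 : φ₀ j ≠ 1 := by
      simpa [φ₀] using hf
    have h : φ₀ j * ∑ φ : AddChar (ZMod n) R, φ j = ∑ φ : AddChar (ZMod n) R, φ j := by
      rw [Finset.mul_sum]
      exact Fintype.sum_equiv (Equiv.mulLeft φ₀) _ _ (fun φ => by simp)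
    by_contra h'
    exact h0 (mul_right_cancel₀ h' (by rw [h, one_mul]))

theorem natCast_ne_zero : (n : R) ≠ 0 := by
  obtain ⟨ζ, hζ⟩ := HasEnoughRootsOfUnity.exists_primitiveRoot R n
  exact (hζ.neZero').ne

end Characters

section Order
variable (R K : Type*) [CommRing R] [Field K] [Algebra R K] (n : ℕ)

/-- For a character `φ` of the cyclic group `C = ⟨σ⟩` (`σ = r 1`, so `C = {r i | i : ZMod n}`), with
values in `μ_n ⊂ R`, the idempotent `e_φ = n⁻¹ ∑_{ζ ∈ C} φ(ζ) ζ⁻¹` of `K[C] ⊂ K[D]`. -/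
noncomputable def idem [NeZero n] (φ : AddChar (ZMod n) R) : MonoidAlgebra K (DihedralGroup n) :=
  ∑ i : ZMod n, MonoidAlgebra.single (DihedralGroup.r (-i)) ((n : K)⁻¹ * algebraMap R K (φ i))

/-- The reflection `τ = sr 0`, as an element of `K[D]`. Here `τ σ τ = σ⁻¹`. -/
noncomputable def tau : MonoidAlgebra K (DihedralGroup n) :=
  MonoidAlgebra.single (DihedralGroup.sr 0) 1

/-- The elements `e_φ` (index `(φ, false)`) and `e_φ τ` (index `(φ, true)`) of `K[D]`. -/
noncomputable def orderVec [NeZero n] (p : AddChar (ZMod n) R × Bool) :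
    MonoidAlgebra K (DihedralGroup n) :=
  idem R K n p.1 * (if p.2 then tau K n else 1)

/-- The action of `⟨τ⟩` on characters: `τ` sends `φ` to `φ̄ = φ⁻¹`. -/
def charAct {n : ℕ} {R : Type*} [CommRing R] (s : Bool) (φ : AddChar (ZMod n) R) : AddChar (ZMod n) R :=
  if s then φ⁻¹ else φ

variable {R n} [NeZero n] 

theorem tau_mul_tau : tau K n * tau K n = 1 := by
  simp [tau, MonoidAlgebra.single_mul_single, MonoidAlgebra.one_def]

theorem tau_mul_idem (φ : AddChar (ZMod n) R) :
    tau K n * idem R K n φ = idem R K n φ⁻¹ * tau K n := by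
  simp only [tau, idem, Finset.mul_sum, Finset.sum_mul, MonoidAlgebra.single_mul_single]
  refine Fintype.sum_equiv (Equiv.neg _) _ _ fun i => ?_
  simp

variable [IsDomain R] [IsFractionRing R K] [HasEnoughRootsOfUnity R n]

theorem natCast_ne_zero' (R K : Type*) [CommRing R] [Field K] [Algebra R K] {n : ℕ} [NeZero n]
    [IsDomain R] [IsFractionRing R K] [HasEnoughRootsOfUnity R n] : (n : K) ≠ 0 := by
  rw [← map_natCast (algebraMap R K)]
  exact fun h => natCast_ne_zero (R := R) (n := n)
    ((IsFractionRing.injective R K) (by simpa using h))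

theorem idem_mul_idem [DecidableEq (AddChar (ZMod n) R)] (φ ψ : AddChar (ZMod n) R) :
    idem R K n φ * idem R K n ψ = if φ = ψ then idem R K n φ else 0 := by
  have hn := natCast_ne_zero' R K (n := n)
  have h1 : idem R K n φ * idem R K n ψ = ∑ k : ZMod n, MonoidAlgebra.single
      (DihedralGroup.r (-k)) ((n : K)⁻¹ * ((n : K)⁻¹ * algebraMap R K
        ((∑ i, (φ * ψ⁻¹) i) * ψ k))) := by
    simp only [idem, Finset.mul_sum, Finset.sum_mul, MonoidAlgebra.single_mul_single, map_sum]
    have hs : ∀ (k : ZMod n) (f : ZMod n → K), MonoidAlgebra.single (DihedralGroup.r (-k)) (∑ i, f i)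
        = ∑ i, MonoidAlgebra.single (DihedralGroup.r (-k)) (f i) := fun k f => by
      rw [← MonoidAlgebra.singleAddHom_apply, map_sum]; rfl
    simp only [hs]
    rw [Finset.sum_comm]
    conv_rhs => rw [Finset.sum_comm]
    refine Finset.sum_congr rfl fun i _ => ?_
    refine Fintype.sum_equiv (Equiv.addRight i) _ _ fun j => ?_
    simp only [Equiv.coe_addRight, DihedralGroup.r_mul_r]
    congr 1
    · congr 1; abel
    · simp only [AddChar.mul_apply, AddChar.inv_apply, AddChar.map_add_eq_mul, map_mul]
      have : algebraMap R K (ψ (-i)) * algebraMap R K (ψ i) = 1 := by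
        rw [← map_mul, ← AddChar.map_add_eq_mul]; simp
      linear_combination (-(n : K)⁻¹ * (n : K)⁻¹ * algebraMap R K (φ i) * algebraMap R K (ψ j)) * this
  rw [h1]
  split_ifs with h
  · subst h
    simp [idem, hn]
  · have : ∑ i, (φ * ψ⁻¹) i = 0 := by
      rw [AddChar.sum_eq_ite, if_neg]
      intro h'
      exact h (mul_inv_eq_one.1 h')
    simp only [this, zero_mul, map_zero, mul_zero, MonoidAlgebra.single_zero,
      Finset.sum_const_zero]

theorem sum_idem : ∑ φ, idem R K n φ = 1 := by
  have hn := natCast_ne_zero' R K (n := n)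
  simp only [idem]
  rw [Finset.sum_comm]
  have hs : ∀ (k : ZMod n) (f : AddChar (ZMod n) R → K),
      ∑ φ, MonoidAlgebra.single (DihedralGroup.r (-k)) (f φ)
        = MonoidAlgebra.single (DihedralGroup.r (-k)) (∑ i, f i) := fun k f => by
      rw [← MonoidAlgebra.singleAddHom_apply, map_sum]; rfl
  simp only [hs, ← Finset.mul_sum, ← map_sum, sum_char]
  rw [Finset.sum_eq_single 0]
  · simp [hn, MonoidAlgebra.one_def]
  · intro b _ hb; simp [hb]
  · simp

theorem idem_mul_single (φ : AddChar (ZMod n) R) (i : ZMod n) :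
    idem R K n φ * MonoidAlgebra.single (DihedralGroup.r i) 1 =
      algebraMap R K (φ i) • idem R K n φ := by
  simp only [idem, Finset.sum_mul, MonoidAlgebra.single_mul_single, Finset.smul_sum,
    MonoidAlgebra.smul_single, mul_one, DihedralGroup.r_mul_r, smul_eq_mul]
  refine Fintype.sum_equiv (Equiv.subRight i) _ _ fun j => ?_
  simp only [Equiv.subRight_apply]
  congr 1
  · congr 1; abel
  · rw [mul_left_comm, ← map_mul, ← AddChar.map_add_eq_mul, add_sub_cancel]

theorem single_r_eq (i : ZMod n) :
    MonoidAlgebra.single (DihedralGroup.r i) (1 : K) =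
      ∑ φ : AddChar (ZMod n) R, algebraMap R K (φ i) • idem R K n φ := by
  rw [← one_mul (MonoidAlgebra.single (DihedralGroup.r i) (1 : K)), ← sum_idem (R := R) K,
    Finset.sum_mul]
  exact Finset.sum_congr rfl fun φ _ => idem_mul_single K φ i

theorem orderVec_mul [DecidableEq (AddChar (ZMod n) R)] (p q : AddChar (ZMod n) R × Bool) :
    orderVec R K n p * orderVec R K n q =
      if p.1 = charAct p.2 q.1 then orderVec R K n (p.1, xor p.2 q.2) else 0 := by
  obtain ⟨φ, s⟩ := p
  obtain ⟨ψ, t⟩ := q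
  have hτ : ∀ x, tau K n * (idem R K n ψ * x) = idem R K n ψ⁻¹ * (tau K n * x) := fun x => by
    rw [← mul_assoc, tau_mul_idem, mul_assoc]
  have he : ∀ (φ ψ : AddChar (ZMod n) R) x, idem R K n φ * (idem R K n ψ * x) =
      (if φ = ψ then idem R K n φ else 0) * x := fun φ ψ x => by
    rw [← mul_assoc, idem_mul_idem]
  cases s <;> cases t <;>
    simp [orderVec, charAct, mul_assoc, hτ, he, idem_mul_idem, tau_mul_tau, tau_mul_idem]

theorem one_eq_sum_orderVec : (1 : MonoidAlgebra K (DihedralGroup n)) =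
    ∑ φ, orderVec R K n (φ, false) := by
  simp [orderVec, sum_idem]

theorem orderVec_coeff (φ : AddChar (ZMod n) R) (s t : Bool) :
    (orderVec R K n (φ, s)).coeff (if t then DihedralGroup.sr 0 else 1) =
      if s = t then (n : K)⁻¹ else 0 := by
  cases s <;> cases t <;>
    simp [orderVec, idem, tau, MonoidAlgebra.single_mul_single, Finset.sum_mul,
      MonoidAlgebra.coeff_sum, Finsupp.finsetSum_apply, Finsupp.single_apply,
      DihedralGroup.one_def, -DihedralGroup.r_zero]

theorem linearIndependent_orderVec : LinearIndependent R (orderVec R K n) := by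
  classical
  have hn := natCast_ne_zero' R K (n := n)
  rw [Fintype.linearIndependent_iff]
  rintro g hg ⟨ψ, t⟩
  have h1 : ∑ p, g p • (orderVec R K n (ψ, false) * orderVec R K n p) = 0 := by
    have := congrArg (orderVec R K n (ψ, false) * ·) hg
    simpa [Finset.mul_sum, mul_smul_comm] using this
  have h2 : ∑ s : Bool, g (ψ, s) • orderVec R K n (ψ, s) = 0 := by
    rw [← h1, Fintype.sum_prod_type, Finset.sum_eq_single ψ]
    · refine Finset.sum_congr rfl fun s _ => ?_
      simp [orderVec_mul, charAct]
    · intro φ _ hφ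
      refine Finset.sum_eq_zero fun s _ => ?_
      simp [orderVec_mul, charAct, Ne.symm hφ]
    · simp
  have h3 := congrArg (fun x => x.coeff (if t then DihedralGroup.sr 0 else 1)) h2
  have h4 : algebraMap R K (g (ψ, t)) * (n : K)⁻¹ = 0 := by
    simp only [MonoidAlgebra.coeff_sum, Finsupp.finsetSum_apply, MonoidAlgebra.coeff_smul,
      Finsupp.smul_apply, orderVec_coeff] at h3
    cases t <;> simpa [Algebra.smul_def] using h3
  have h5 := (mul_eq_zero.1 h4).resolve_right (inv_ne_zero hn)
  exact (IsFractionRing.injective R K) (by simpa using h5)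

end Order

section Hopf
variable (R K : Type*) [CommRing R] [IsDomain R] [Field K] [Algebra R K] [IsFractionRing R K]
  (n : ℕ) [NeZero n] [HasEnoughRootsOfUnity R n]

/-- The twisted group ring `H = ℳ ∘ ⟨τ⟩ = ℳ ⊕ ℳ τ` inside `K[D]`, where `ℳ = ⊕_φ R e_φ` is the split
maximal order of `K[C]`: the `R`-span of all `e_φ` and `e_φ τ`. -/
noncomputable def dihedralOrder : Subalgebra R (MonoidAlgebra K (DihedralGroup n)) :=
  (Submodule.span R (Set.range (orderVec R K n))).toSubalgebra
    (by
      rw [one_eq_sum_orderVec (R := R) K]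
      exact Submodule.sum_mem _ fun φ _ => Submodule.subset_span ⟨_, rfl⟩)
    (fun x y hx hy => by
      classical
      induction hx using Submodule.span_induction with
      | zero => simp
      | add a b _ _ ha hb => rw [add_mul]; exact Submodule.add_mem _ ha hb
      | smul r a _ ha => rw [smul_mul_assoc]; exact Submodule.smul_mem _ _ ha
      | mem a ha =>
        obtain ⟨p, rfl⟩ := ha
        induction hy using Submodule.span_induction with
        | zero => simp
        | add a b _ _ ha hb => rw [mul_add]; exact Submodule.add_mem _ ha hb
        | smul r a _ ha => rw [mul_smul_comm]; exact Submodule.smul_mem _ _ ha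
        | mem b hb =>
          obtain ⟨q, rfl⟩ := hb
          rw [orderVec_mul]
          split_ifs
          · exact Submodule.subset_span ⟨_, rfl⟩
          · exact Submodule.zero_mem _)

/-- `e_φ` and `e_φ τ` as elements of `H`. -/
noncomputable def orderGen (p : AddChar (ZMod n) R × Bool) : dihedralOrder R K n :=
  ⟨orderVec R K n p, Submodule.subset_span ⟨p, rfl⟩⟩

/-- The elements `e_φ`, `e_φ τ` form an `R`-basis of `H`. -/
noncomputable def orderBasis : Module.Basis (AddChar (ZMod n) R × Bool) R (dihedralOrder R K n) :=
  Module.Basis.mk (v := orderGen R K n)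
    (LinearIndependent.of_comp (dihedralOrder R K n).val.toLinearMap
      (linearIndependent_orderVec K))
    (by
      rintro ⟨x, hx⟩ -
      change x ∈ Submodule.span R (Set.range (orderVec R K n)) at hx
      induction hx using Submodule.span_induction with
      | zero => exact Submodule.zero_mem _
      | add a b ha hb ha' hb' => exact Submodule.add_mem _ ha' hb'
      | smul r a _ ha => exact Submodule.smul_mem _ _ ha
      | mem a ha =>
        obtain ⟨p, rfl⟩ := ha
        exact Submodule.subset_span ⟨p, rfl⟩)

@[simp] theorem orderBasis_apply (p : AddChar (ZMod n) R × Bool) :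
    orderBasis R K n p = orderGen R K n p := by simp [orderBasis]

instance : Module.Free R (dihedralOrder R K n) := .of_basis (orderBasis R K n)
instance : Module.Finite R (dihedralOrder R K n) := .of_basis (orderBasis R K n)

theorem orderGen_mul [DecidableEq (AddChar (ZMod n) R)] (p q : AddChar (ZMod n) R × Bool) :
    orderGen R K n p * orderGen R K n q =
      if p.1 = charAct p.2 q.1 then orderGen R K n (p.1, xor p.2 q.2) else 0 := by
  apply Subtype.ext
  have := orderVec_mul (R := R) K (n := n) p q
  split_ifs with h <;> simpa [orderGen, h] using this

theorem one_eq_sum_orderGen : (1 : dihedralOrder R K n) = ∑ φ, orderGen R K n (φ, false) := by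
  apply Subtype.ext
  simpa [orderGen] using one_eq_sum_orderVec (R := R) K (n := n)

/-- The comultiplication of `H`: `Δ(e_φ) = ∑_{αβ = φ} e_α ⊗ e_β` and `Δ(e_φ τ) = Δ(e_φ) (τ ⊗ τ)`. It is
the restriction of the comultiplication of `K[D]`, see `orderTensorVal_comul`. -/
noncomputable def orderComulLin :
    dihedralOrder R K n →ₗ[R] dihedralOrder R K n ⊗[R] dihedralOrder R K n :=
  (orderBasis R K n).constr R fun p =>
    ∑ α, orderGen R K n (α, p.2) ⊗ₜ[R] orderGen R K n (p.1 * α⁻¹, p.2)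

open Classical in
/-- The counit of `H`: `ε(e_φ) = ε(e_φ τ)` is `1` if `φ` is trivial and `0` otherwise. It is the
restriction of the counit of `K[D]`, see `counit_coe`. -/
noncomputable def orderCounitLin : dihedralOrder R K n →ₗ[R] R :=
  (orderBasis R K n).constr R fun p => if p.1 = 1 then 1 else 0

/-- The antipode of `H`: `S(e_φ) = e_{φ̄}` and `S(e_φ τ) = τ e_{φ̄} = e_φ τ`. -/
noncomputable def orderAntipode : dihedralOrder R K n →ₗ[R] dihedralOrder R K n :=
  (orderBasis R K n).constr R fun p => orderGen R K n (if p.2 then p.1 else p.1⁻¹, p.2)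

theorem orderComulLin_gen (p : AddChar (ZMod n) R × Bool) :
    orderComulLin R K n (orderGen R K n p) =
      ∑ α, orderGen R K n (α, p.2) ⊗ₜ[R] orderGen R K n (p.1 * α⁻¹, p.2) := by
  rw [← orderBasis_apply, orderComulLin, Module.Basis.constr_basis]

theorem orderCounitLin_gen [DecidableEq (AddChar (ZMod n) R)] (p : AddChar (ZMod n) R × Bool) :
    orderCounitLin R K n (orderGen R K n p) = if p.1 = 1 then 1 else 0 := by
  rw [← orderBasis_apply, orderCounitLin, Module.Basis.constr_basis]
  congr

theorem orderAntipode_gen (p : AddChar (ZMod n) R × Bool) :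
    orderAntipode R K n (orderGen R K n p) =
      orderGen R K n (if p.2 then p.1 else p.1⁻¹, p.2) := by
  rw [← orderBasis_apply, orderAntipode, Module.Basis.constr_basis]

theorem charAct_charAct (s : Bool) (φ : AddChar (ZMod n) R) : charAct s (charAct s φ) = φ := by
  cases s <;> simp [charAct]

theorem charAct_mul (s : Bool) (φ ψ : AddChar (ZMod n) R) :
    charAct s (φ * ψ) = charAct s φ * charAct s ψ := by
  cases s <;> simp [charAct, mul_comm]

theorem charAct_inv (s : Bool) (φ : AddChar (ZMod n) R) : charAct s φ⁻¹ = (charAct s φ)⁻¹ := by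
  cases s <;> simp [charAct]

theorem charAct_eq_one (s : Bool) (φ : AddChar (ZMod n) R) : charAct s φ = 1 ↔ φ = 1 := by
  cases s <;> simp [charAct]

theorem orderComulLin_mul (x y : dihedralOrder R K n) :
    orderComulLin R K n (x * y) = orderComulLin R K n x * orderComulLin R K n y := by
  classical
  suffices h : (LinearMap.mul R (dihedralOrder R K n)).compr₂ (orderComulLin R K n) =
      (LinearMap.mul R (dihedralOrder R K n ⊗[R] dihedralOrder R K n)).compl₁₂
        (orderComulLin R K n) (orderComulLin R K n) from
    LinearMap.congr_fun₂ h x y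
  refine (orderBasis R K n).ext fun p => (orderBasis R K n).ext fun q => ?_
  simp only [orderBasis_apply, LinearMap.compr₂_apply, LinearMap.mul_apply_apply,
    LinearMap.compl₁₂_apply, orderGen_mul, orderComulLin_gen, Finset.sum_mul, Finset.mul_sum,
    Algebra.TensorProduct.tmul_mul_tmul]
  rw [show (orderComulLin R K n) (if p.1 = charAct p.2 q.1 then orderGen R K n (p.1, xor p.2 q.2)
    else 0) = if p.1 = charAct p.2 q.1 then orderComulLin R K n (orderGen R K n (p.1, xor p.2 q.2))
    else 0 by split_ifs <;> simp]
  rw [orderComulLin_gen]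
  have key : ∀ α : AddChar (ZMod n) R, ∑ β : AddChar (ZMod n) R,
      (if α = charAct p.2 β then orderGen R K n (α, xor p.2 q.2) else 0) ⊗ₜ[R]
      (if p.1 * α⁻¹ = charAct p.2 (q.1 * β⁻¹) then orderGen R K n (p.1 * α⁻¹, xor p.2 q.2) else 0) =
      if p.1 = charAct p.2 q.1 then
        orderGen R K n (α, xor p.2 q.2) ⊗ₜ[R] orderGen R K n (p.1 * α⁻¹, xor p.2 q.2) else 0 := by
    intro α
    rw [Finset.sum_eq_single (charAct p.2 α)]
    · simp only [charAct_charAct, charAct_mul, charAct_inv, if_true, mul_left_inj]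
      split_ifs <;> simp
    · intro β _ hβ
      rw [if_neg, TensorProduct.zero_tmul]
      rintro rfl
      exact hβ (charAct_charAct _ _ _ _).symm
    · simp
  rw [Finset.sum_comm, Finset.sum_congr rfl fun α _ => key α]
  split_ifs <;> simp

theorem orderCounitLin_mul (x y : dihedralOrder R K n) :
    orderCounitLin R K n (x * y) = orderCounitLin R K n x * orderCounitLin R K n y := by
  classical
  suffices h : (LinearMap.mul R (dihedralOrder R K n)).compr₂ (orderCounitLin R K n) =
      (LinearMap.mul R R).compl₁₂ (orderCounitLin R K n) (orderCounitLin R K n) from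
    LinearMap.congr_fun₂ h x y
  refine (orderBasis R K n).ext fun p => (orderBasis R K n).ext fun q => ?_
  simp only [orderBasis_apply, LinearMap.compr₂_apply, LinearMap.mul_apply_apply,
    LinearMap.compl₁₂_apply, orderGen_mul, orderCounitLin_gen]
  rw [show (orderCounitLin R K n) (if p.1 = charAct p.2 q.1 then orderGen R K n (p.1, xor p.2 q.2)
    else 0) = if p.1 = charAct p.2 q.1 then orderCounitLin R K n (orderGen R K n (p.1, xor p.2 q.2))
    else 0 by split_ifs <;> simp]
  rw [orderCounitLin_gen]
  by_cases h : p.1 = 1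
  · by_cases h' : q.1 = 1
    · simp [h, h', (charAct_eq_one R n p.2 1).2 rfl]
    · have : ¬ (1 = charAct p.2 q.1) := fun e => h' ((charAct_eq_one R n _ _).1 e.symm)
      simp [h, h', this]
  · simp [h]

noncomputable def orderComul :
    dihedralOrder R K n →ₐ[R] dihedralOrder R K n ⊗[R] dihedralOrder R K n :=
  AlgHom.ofLinearMap (orderComulLin R K n)
    (by
      simp only [one_eq_sum_orderGen, map_sum, orderComulLin_gen,
        Algebra.TensorProduct.one_def, TensorProduct.sum_tmul, TensorProduct.tmul_sum]
      rw [Finset.sum_comm]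
      conv_rhs => rw [Finset.sum_comm]
      refine Finset.sum_congr rfl fun α _ => ?_
      exact Fintype.sum_equiv (Equiv.mulRight α⁻¹) _ _ fun φ => rfl)
    (orderComulLin_mul R K n)

noncomputable def orderCounit : dihedralOrder R K n →ₐ[R] R :=
  AlgHom.ofLinearMap (orderCounitLin R K n)
    (by classical simp [one_eq_sum_orderGen, orderCounitLin_gen])
    (orderCounitLin_mul R K n)

theorem orderComul_gen (p : AddChar (ZMod n) R × Bool) :
    orderComul R K n (orderGen R K n p) =
      ∑ α, orderGen R K n (α, p.2) ⊗ₜ[R] orderGen R K n (p.1 * α⁻¹, p.2) :=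
  orderComulLin_gen R K n p

theorem orderCounit_gen [DecidableEq (AddChar (ZMod n) R)] (p : AddChar (ZMod n) R × Bool) :
    orderCounit R K n (orderGen R K n p) = if p.1 = 1 then 1 else 0 :=
  orderCounitLin_gen R K n p

theorem algHom_ext_order {S : Type*} [Semiring S] [Algebra R S] {f g : dihedralOrder R K n →ₐ[R] S}
    (h : ∀ p, f (orderGen R K n p) = g (orderGen R K n p)) : f = g :=
  AlgHom.toLinearMap_injective ((orderBasis R K n).ext fun p => by simpa using h p)

noncomputable instance : Bialgebra R (dihedralOrder R K n) :=
  Bialgebra.ofAlgHom (orderComul R K n) (orderCounit R K n)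
    (by
      refine algHom_ext_order R K n fun p => ?_
      simp [orderComul_gen, TensorProduct.sum_tmul, TensorProduct.tmul_sum]
      rw [Finset.sum_comm]
      refine Finset.sum_congr rfl fun α _ => ?_
      refine Fintype.sum_equiv (Equiv.mulRight α⁻¹) _ _ fun β => ?_
      simp)
    (by
      classical
      refine algHom_ext_order R K n fun p => ?_
      simp [orderComul_gen, orderCounit_gen, TensorProduct.ite_tmul])
    (by
      classical
      refine algHom_ext_order R K n fun p => ?_
      simp [orderComul_gen, orderCounit_gen, TensorProduct.tmul_ite, mul_inv_eq_one])

theorem comul_gen (p : AddChar (ZMod n) R × Bool) :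
    Coalgebra.comul (R := R) (orderGen R K n p) =
      ∑ α, orderGen R K n (α, p.2) ⊗ₜ[R] orderGen R K n (p.1 * α⁻¹, p.2) :=
  orderComulLin_gen R K n p

theorem counit_gen [DecidableEq (AddChar (ZMod n) R)] (p : AddChar (ZMod n) R × Bool) :
    Coalgebra.counit (R := R) (orderGen R K n p) = if p.1 = 1 then 1 else 0 :=
  orderCounitLin_gen R K n p

instance : Coalgebra.IsCocomm R (dihedralOrder R K n) where
  comm_comp_comul := by
    refine (orderBasis R K n).ext fun p => ?_
    simp [comul_gen]
    exact Fintype.sum_equiv (Equiv.divLeft p.1) _ _ fun α => by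
      simp [div_eq_mul_inv]

noncomputable instance : HopfAlgebra R (dihedralOrder R K n) where
  antipode := orderAntipode R K n
  mul_antipode_rTensor_comul := by
    classical
    refine (orderBasis R K n).ext fun p => ?_
    obtain ⟨φ, s⟩ := p
    cases s <;> simp [comul_gen, counit_gen, orderAntipode_gen, orderGen_mul, charAct,
      one_eq_sum_orderGen R K n]
    congr 1
    exact Fintype.sum_equiv (Equiv.inv _) _ _ fun α => rfl
  mul_antipode_lTensor_comul := by
    classical
    refine (orderBasis R K n).ext fun p => ?_
    obtain ⟨φ, s⟩ := p
    cases s <;> simp [comul_gen, counit_gen, orderAntipode_gen, orderGen_mul, charAct,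
      one_eq_sum_orderGen R K n]

/-- The natural map `H ⊗_R H → K[D] ⊗_K K[D]`. -/
noncomputable def orderTensorVal : dihedralOrder R K n ⊗[R] dihedralOrder R K n →ₗ[R]
    MonoidAlgebra K (DihedralGroup n) ⊗[K] MonoidAlgebra K (DihedralGroup n) :=
  TensorProduct.lift (((TensorProduct.mk K _ _).restrictScalars₁₂ R R).compl₁₂
    (dihedralOrder R K n).val.toLinearMap (dihedralOrder R K n).val.toLinearMap)

theorem orderTensorVal_tmul (x y : dihedralOrder R K n) :
    orderTensorVal R K n (x ⊗ₜ y) =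
      (x : MonoidAlgebra K (DihedralGroup n)) ⊗ₜ[K] (y : MonoidAlgebra K (DihedralGroup n)) := rfl

/-- The comultiplication of `H` is the restriction of that of `K[D]`. -/
theorem orderTensorVal_comul (x : dihedralOrder R K n) :
    orderTensorVal R K n (Coalgebra.comul (R := R) x) =
      Coalgebra.comul (R := K) (x : MonoidAlgebra K (DihedralGroup n)) := by
  have hn := natCast_ne_zero' R K (n := n)
  have hs : ∀ (d : DihedralGroup n) (a : K), MonoidAlgebra.single d a =
      a • (MonoidAlgebra.single d (1 : K)) := fun d a => by simp
  have hidem : ∀ φ : AddChar (ZMod n) R, Coalgebra.comul (R := K) (idem R K n φ) =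
      ∑ α, idem R K n α ⊗ₜ[K] idem R K n (φ * α⁻¹) := by
    intro φ
    have hφ : ∀ φ : AddChar (ZMod n) R, idem R K n φ = ∑ i : ZMod n,
        ((n : K)⁻¹ * algebraMap R K (φ i)) •
          MonoidAlgebra.single (DihedralGroup.r (-i)) (1 : K) := fun φ => by
      simp [idem]
    have hinner : ∀ i : ZMod n, ∑ α : AddChar (ZMod n) R,
        algebraMap R K (α i) • idem R K n (φ * α⁻¹) =
          algebraMap R K (φ i) • MonoidAlgebra.single (DihedralGroup.r (-i)) (1 : K) := fun i => by
      rw [single_r_eq (R := R), Finset.smul_sum]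
      refine Fintype.sum_equiv (Equiv.divLeft φ) _ _ fun α => ?_
      have h : φ i * φ (-i) = 1 := by rw [← AddChar.map_add_eq_mul]; simp
      rw [Equiv.divLeft_apply, smul_smul, ← map_mul, div_eq_mul_inv, AddChar.mul_apply,
        AddChar.inv_apply, neg_neg, ← mul_assoc, h, one_mul]
    calc Coalgebra.comul (R := K) (idem R K n φ)
        = ∑ i : ZMod n, ((n : K)⁻¹ * algebraMap R K (φ i)) •
          (MonoidAlgebra.single (DihedralGroup.r (-i)) (1 : K) ⊗ₜ[K]
            MonoidAlgebra.single (DihedralGroup.r (-i)) (1 : K)) := by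
          rw [hφ, map_sum]
          refine Finset.sum_congr rfl fun i _ => ?_
          rw [map_smul, MonoidAlgebra.comul_single]
          simp
      _ = ∑ i : ZMod n, (n : K)⁻¹ • (MonoidAlgebra.single (DihedralGroup.r (-i)) (1 : K) ⊗ₜ[K]
            ∑ α : AddChar (ZMod n) R, algebraMap R K (α i) • idem R K n (φ * α⁻¹)) := by
          refine Finset.sum_congr rfl fun i _ => ?_
          rw [hinner, TensorProduct.tmul_smul, smul_smul]
      _ = ∑ α, idem R K n α ⊗ₜ[K] idem R K n (φ * α⁻¹) := by
          simp only [TensorProduct.tmul_sum, Finset.smul_sum]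
          rw [Finset.sum_comm]
          refine Finset.sum_congr rfl fun α _ => ?_
          rw [hφ α, TensorProduct.sum_tmul]
          refine Finset.sum_congr rfl fun i _ => ?_
          rw [TensorProduct.tmul_smul, TensorProduct.smul_tmul', TensorProduct.smul_tmul',
            smul_smul]
  have key : (Coalgebra.comul (R := K) (A := MonoidAlgebra K (DihedralGroup n))).restrictScalars R ∘ₗ
      (dihedralOrder R K n).val.toLinearMap = orderTensorVal R K n ∘ₗ Coalgebra.comul (R := R) := by
    refine (orderBasis R K n).ext fun p => ?_
    obtain ⟨φ, s⟩ := p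
    have hτ : Coalgebra.comul (R := K) (if s then tau K n else 1) =
        (if s then tau K n else 1) ⊗ₜ[K] (if s then tau K n else 1) := by
      cases s <;> simp [tau, Algebra.TensorProduct.one_def]
    simp only [orderBasis_apply, LinearMap.comp_apply, comul_gen, map_sum, orderTensorVal_tmul]
    change Coalgebra.comul (R := K) (idem R K n φ * (if s then tau K n else 1)) = _
    rw [Bialgebra.comul_mul, hidem, hτ, Finset.sum_mul]
    refine Finset.sum_congr rfl fun α _ => ?_
    rw [Algebra.TensorProduct.tmul_mul_tmul]
    rfl
  exact (LinearMap.congr_fun key x).symm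

/-- The counit of `H` is the restriction of that of `K[D]`. -/
theorem counit_coe (x : dihedralOrder R K n) :
    algebraMap R K (Coalgebra.counit (R := R) x) =
      Coalgebra.counit (R := K) (x : MonoidAlgebra K (DihedralGroup n)) := by
  classical
  have hn := natCast_ne_zero' R K (n := n)
  have key : (Coalgebra.counit (R := K) (A := MonoidAlgebra K (DihedralGroup n))).restrictScalars R
      ∘ₗ (dihedralOrder R K n).val.toLinearMap =
      Algebra.linearMap R K ∘ₗ Coalgebra.counit (R := R) := by
    refine (orderBasis R K n).ext fun p => ?_
    obtain ⟨φ, s⟩ := p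
    have hτ : Coalgebra.counit (R := K) (if s then tau K n else 1) = 1 := by
      cases s <;> simp [tau]
    simp only [orderBasis_apply, LinearMap.comp_apply, counit_gen]
    change Coalgebra.counit (R := K) (idem R K n φ * (if s then tau K n else 1)) = _
    rw [Bialgebra.counit_mul, hτ, mul_one]
    simp only [idem, map_sum, MonoidAlgebra.counit_single, CommSemiring.counit_apply]
    rw [← Finset.mul_sum, ← map_sum, AddChar.sum_eq_ite]
    change _ = algebraMap R K (if φ = 1 then 1 else 0)
    by_cases h : φ = 0
    · have h' : φ = 1 := h
      rw [if_pos h, if_pos h']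
      simp [hn]
    · have h' : ¬ φ = 1 := h
      rw [if_neg h, if_neg h']
      simp
  exact (LinearMap.congr_fun key x).symm

theorem single_mem_order (d : DihedralGroup n) :
    MonoidAlgebra.single d (1 : K) ∈ dihedralOrder R K n := by
  have hn := natCast_ne_zero' R K (n := n)
  have hr : ∀ i : ZMod n, MonoidAlgebra.single (DihedralGroup.r i) (1 : K) ∈ dihedralOrder R K n := by
    intro i
    have h : MonoidAlgebra.single (DihedralGroup.r i) (1 : K) =
        ∑ φ : AddChar (ZMod n) R, φ i • idem R K n φ := by
      simpa using single_r_eq (R := R) K i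
    rw [h]
    refine sum_mem fun φ _ => (dihedralOrder R K n).smul_mem ?_ _
    simpa [orderGen, orderVec] using (orderGen R K n (φ, false)).2
  have ht : tau K n ∈ dihedralOrder R K n := by
    have : tau K n = ∑ φ : AddChar (ZMod n) R, orderVec R K n (φ, true) := by
      simp [orderVec, ← Finset.sum_mul, sum_idem]
    rw [this]
    exact sum_mem fun φ _ => (orderGen R K n (φ, true)).2
  cases d with
  | r i => exact hr i
  | sr i =>
    have := mul_mem (hr (-i)) ht
    simpa [tau, MonoidAlgebra.single_mul_single] using this

/-- The group elements `d ∈ D`, as elements of `H ⊃ R[D]`. -/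
noncomputable def groupElt (d : DihedralGroup n) : dihedralOrder R K n :=
  ⟨MonoidAlgebra.single d 1, single_mem_order R K n d⟩

open Classical in
/-- The integral `θ^D` of `H = A^D` used for the twist: `n⁻¹ ∑_{d ∈ D} d`, except that it is
`∑_{d ∈ D} d` if `n` is a unit of `R` (see `coe_twistIntegral`; note that
`e_1 + e_1 τ = n⁻¹ ∑_d d`). It is the element of `H` with `θ^D θ = 1_A`, where `θ = c⁻² l₀ ∈ A`, `l₀` is
the function with `l₀(1) = 1` and `l₀(d) = 0` for `d ≠ 1`, and `c` is `twistScalar`. -/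
noncomputable def twistIntegral : dihedralOrder R K n :=
  (if IsUnit (n : R) then (n : R) else 1) •
    (orderGen R K n (1, false) + orderGen R K n (1, true))

open Classical in
/-- The scalar `c`: it is `1` if `n` is a unit of `R`, and `n^{-1/2} = s⁻¹` otherwise, where
`s = n^{1/2}` is a given square root of `n` in `R`. -/
noncomputable def twistScalar (s : R) : K :=
  if IsUnit (n : R) then 1 else (algebraMap R K s)⁻¹

open Classical in
/-- `θ^D = c² ∑_{d ∈ D} d`. -/
theorem coe_twistIntegral (s : R) (hs : ¬ IsUnit (n : R) → s ^ 2 = n) :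
    (twistIntegral R K n : MonoidAlgebra K (DihedralGroup n)) =
      twistScalar R K n s ^ 2 • ∑ d : DihedralGroup n, MonoidAlgebra.single d (1 : K) := by
  have hn := natCast_ne_zero' R K (n := n)
  have h1 : (orderGen R K n (1, false) + orderGen R K n (1, true) : dihedralOrder R K n) =
      (n : K)⁻¹ • ∑ d : DihedralGroup n, MonoidAlgebra.single d (1 : K) := by
    have hd : ∑ d : DihedralGroup n, MonoidAlgebra.single d (1 : K) =
        ∑ i : ZMod n, MonoidAlgebra.single (DihedralGroup.r i) (1 : K) +
          ∑ i : ZMod n, MonoidAlgebra.single (DihedralGroup.sr i) (1 : K) := by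
      rw [← Fintype.sum_equiv DihedralGroup.equivSum.symm
        (fun x => MonoidAlgebra.single (DihedralGroup.equivSum.symm x) (1 : K)) _ (fun _ => rfl),
        Fintype.sum_sum_type]
      rfl
    rw [hd, smul_add]
    change orderVec R K n (1, false) + orderVec R K n (1, true) = _
    congr 1
    · simp only [orderVec, idem, Finset.smul_sum]
      simp
      exact Fintype.sum_equiv (Equiv.neg _) _ _ fun i => by simp
    · simp only [orderVec, idem, tau, Finset.smul_sum]
      simp [Finset.sum_mul, MonoidAlgebra.single_mul_single]
  have h2 : ((twistIntegral R K n : dihedralOrder R K n) : MonoidAlgebra K (DihedralGroup n)) =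
      algebraMap R K (if IsUnit (n : R) then (n : R) else 1) •
        ((orderGen R K n (1, false) + orderGen R K n (1, true) : dihedralOrder R K n) :
          MonoidAlgebra K (DihedralGroup n)) := by
    rw [algebraMap_smul]; rfl
  rw [h2, h1, smul_smul]
  congr 1
  unfold twistScalar
  split_ifs with hu
  · simp [hn]
  · have : algebraMap R K s ^ 2 = n := by rw [← map_pow, hs hu, map_natCast]
    rw [inv_pow, this]; simp

end Hopf

section Form
variable (R K : Type*) [CommRing R] [IsDomain R] [Field K] [Algebra R K] [IsFractionRing R K]
  (n : ℕ) [NeZero n] [HasEnoughRootsOfUnity R n]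

/-- The trace `tr : K[D] → K`, `tr(1) = 2n` and `tr(d) = 0` for `d ≠ 1`. -/
noncomputable def groupTrace : MonoidAlgebra K (DihedralGroup n) →ₗ[K] K where
  toFun x := (2 * n : K) * x.coeff 1
  map_add' x y := by simp [mul_add]
  map_smul' a x := by simp [mul_left_comm]

/-- The bilinear form `(x, y) ↦ (1/2) tr(x τ ȳ)` on `K[D]`, where `y ↦ ȳ` is the `K`-linear
involution with `d ↦ d⁻¹`, i.e. the antipode of `K[D]`. -/
noncomputable def groupForm : MonoidAlgebra K (DihedralGroup n) →ₗ[K]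
    MonoidAlgebra K (DihedralGroup n) →ₗ[K] K :=
  LinearMap.mk₂ K (fun x y => 2⁻¹ * groupTrace K n (x * tau K n * HopfAlgebra.antipode K y))
    (fun x x' y => by simp [add_mul, mul_add]) (fun a x y => by simp [mul_left_comm])
    (fun x y y' => by simp [mul_add]) (fun a x y => by simp [mul_left_comm])

/-- The module `M = R e_χ ⊕ R e_{χ̄} τ` inside `K[D]`. -/
noncomputable def dihedralModule (χ : AddChar (ZMod n) R) : Submodule R (MonoidAlgebra K (DihedralGroup n)) :=
  Submodule.span R {idem R K n χ, idem R K n χ⁻¹ * tau K n}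

theorem order_mul_mem (χ : AddChar (ZMod n) R) {h x : MonoidAlgebra K (DihedralGroup n)}
    (hh : h ∈ dihedralOrder R K n) (hx : x ∈ dihedralModule R K n χ) :
    h * x ∈ dihedralModule R K n χ := by
  classical
  change h ∈ Submodule.span R (Set.range (orderVec R K n)) at hh
  induction hh using Submodule.span_induction with
  | zero => simp
  | add a b _ _ ha hb => rw [add_mul]; exact Submodule.add_mem _ ha hb
  | smul r a _ ha => rw [smul_mul_assoc]; exact Submodule.smul_mem _ _ ha
  | mem a ha =>
    obtain ⟨⟨φ, s⟩, rfl⟩ := ha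
    unfold dihedralModule at hx ⊢
    induction hx using Submodule.span_induction with
    | zero => simp
    | add a b _ _ ha hb => rw [mul_add]; exact Submodule.add_mem _ ha hb
    | smul r a _ ha => rw [mul_smul_comm]; exact Submodule.smul_mem _ _ ha
    | mem b hb =>
      have h1 : orderVec R K n (χ, false) = idem R K n χ := by simp [orderVec]
      have h2 : orderVec R K n (χ⁻¹, true) = idem R K n χ⁻¹ * tau K n := by simp [orderVec]
      have m1 : orderVec R K n (χ, false) ∈
          Submodule.span R {idem R K n χ, idem R K n χ⁻¹ * tau K n} := by
        rw [h1]; exact Submodule.subset_span (by simp)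
      have m2 : orderVec R K n (χ⁻¹, true) ∈
          Submodule.span R {idem R K n χ, idem R K n χ⁻¹ * tau K n} := by
        rw [h2]; exact Submodule.subset_span (by simp)
      have k1 : orderVec R K n (charAct s χ, xor s false) ∈
          Submodule.span R {idem R K n χ, idem R K n χ⁻¹ * tau K n} := by
        cases s
        · exact m1
        · exact m2
      have k2 : orderVec R K n (charAct s χ⁻¹, xor s true) ∈
          Submodule.span R {idem R K n χ, idem R K n χ⁻¹ * tau K n} := by
        cases s
        · exact m2
        · simpa [charAct] using m1
      have hb' : b = orderVec R K n (χ, false) ∨ b = orderVec R K n (χ⁻¹, true) := by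
        rw [h1, h2]; exact hb
      rcases hb' with rfl | rfl
      · rw [orderVec_mul]
        split_ifs with h
        · have h' : φ = charAct s χ := h
          subst h'
          exact k1
        · exact Submodule.zero_mem _
      · rw [orderVec_mul]
        split_ifs with h
        · have h' : φ = charAct s χ⁻¹ := h
          subst h'
          exact k2
        · exact Submodule.zero_mem _

/-- The action of `H` on `M` by left multiplication in `K[D]`. -/
noncomputable def moduleAct (χ : AddChar (ZMod n) R) :
    dihedralOrder R K n →ₗ[R] Module.End R (dihedralModule R K n χ) where
  toFun h := (LinearMap.mulLeft R (h : MonoidAlgebra K (DihedralGroup n))).restrict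
    fun _ hx => order_mul_mem R K n χ h.2 hx
  map_add' _ _ := LinearMap.ext fun _ => Subtype.ext (add_mul _ _ _)
  map_smul' _ _ := LinearMap.ext fun _ => Subtype.ext (smul_mul_assoc _ _ _)

/-- The form `q(x, y) = (1/2) tr(x τ ȳ)` on `M`. -/
noncomputable def moduleForm (χ : AddChar (ZMod n) R) :
    dihedralModule R K n χ →ₗ[R] dihedralModule R K n χ →ₗ[R] K :=
  ((groupForm K n).restrictScalars₁₂ R R).domRestrict₁₂ _ _

/-- The basis vector `e_χ` of `M`. -/
noncomputable def vecOne (χ : AddChar (ZMod n) R) : dihedralModule R K n χ :=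
  ⟨idem R K n χ, Submodule.subset_span (by simp)⟩

/-- The basis vector `e_{χ̄} τ` of `M`. -/
noncomputable def vecTwo (χ : AddChar (ZMod n) R) : dihedralModule R K n χ :=
  ⟨idem R K n χ⁻¹ * tau K n, Submodule.subset_span (by simp)⟩

variable {R n} {B : Type*} [CommRing B] [Algebra R B]
  (coact : B →ₐ[R] B ⊗[R] DualAlg R (dihedralOrder R K n))

/-- The `-1`-eigenspace `E₋` of `τ` on `E = B^C`: the `b ∈ B` with `σ b = b` and `τ b = -b`. -/
def minusPart : Submodule R B where
  carrier := {b | dualAct coact (groupElt R K n (DihedralGroup.r 1)) b = b ∧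
    dualAct coact (groupElt R K n (DihedralGroup.sr 0)) b = -b}
  add_mem' {b b'} hb hb' := by
    refine ⟨?_, ?_⟩
    · rw [map_add, hb.1, hb'.1]
    · rw [map_add, hb.2, hb'.2, neg_add]
  zero_mem' := by simp
  smul_mem' r b hb := by
    refine ⟨?_, ?_⟩
    · rw [map_smul, hb.1]
    · rw [map_smul, hb.2, smul_neg]

/-- The diagonal action of `H` on `c B ⊗_R M`. -/
noncomputable def twistAct (χ : AddChar (ZMod n) R) (c : K) : dihedralOrder R K n →ₗ[R]
    Module.End R (scaledLattice R K B c ⊗[R] dihedralModule R K n χ) :=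
  diagAct (scaledAct K (dualAct coact) c) (moduleAct R K n χ)

/-- The module `M̃_B = (c B ⊗_R M)^A` underlying the twist. -/
noncomputable def twistModule (χ : AddChar (ZMod n) R) (c : K) :
    Submodule R (scaledLattice R K B c ⊗[R] dihedralModule R K n χ) :=
  fixedModule (twistAct K coact χ c)

/-- `β` is the twisted form `q̃_B = (Tr ⊗ q)^A` on `M̃_B = (c B ⊗_R M)^A`, for the integral `θ` of
`H = A^D`. -/
def IsTwistedForm (χ : AddChar (ZMod n) R) (c : K) (θ : dihedralOrder R K n)
    (β : LinearMap.BilinForm R (twistModule K coact χ c)) : Prop :=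
  IsInducedForm (twistAct K coact χ c)
    (tensorForm K (scaledTrace R K B c) (moduleForm R K n χ)) θ β

end Form

end DihedralTwist

open DihedralTwist

/-! Write `N` for the counit of `θ^D`. The argument reduces everything from the Hopf order `H` to
the group `D`. The elements of `D` are grouplike in `H`, so they act on `B` by algebra
automorphisms, and `n H ⊂ R[D]`, so a linear map from `H` to a torsion free module is determined on
`D` (`hom_ext_groupElt`). In particular, being fixed by `H` just means being fixed by `σ` and `τ`
(`fixed_of_fixed`).

Basis. Since `M` is free on `e_χ` and `e_{χ̄} τ`, an element of `cB ⊗ M` is a unique pair `(x, y)`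
of elements of `B` (`pairElt`). It is fixed exactly when `σ x = χ̄(σ) x` and `y = τ x`
(`IsPHS.pairElt_mem_twistModule`). The unit `α^τ` is such an `x`, so dividing by it identifies the
fixed module with `B^C`. As 2 is invertible, `B^C = R ⊕ R δ` (`IsPHS.exists_eq_add_smul`); the
generators `1` and `δ` give `ε₁` and `ε₂`.

Units. The torsor property makes `δ` invertible in `B` (`IsPHS.isUnit_of_span_eq_minusPart`). Then
`α α^τ` and `δ²` are units of `B` fixed by `σ` and `τ`, hence units of `R`.

Form. `q` is a hyperbolic plane on `M`, so `Tr ⊗ q` takes `(x, y)`, `(x', y')` to `c² Tr(x y' + y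
x')`. On the basis the argument of the trace lies in `R`, where the trace is multiplication by the
rank `2n` of `B`. The resulting factor `2 n c²` is exactly `N` (`twistScalar_sq`), and `N` is a unit
of `R`. Since `Tr ⊗ q` is `D`-invariant, `(Tr ⊗ q)(θ^D m, y) = N (Tr ⊗ q)(m, y)` for fixed `y`
(`IsPHS.tensorForm_act_left`). So the twisted form is `N⁻¹ (Tr ⊗ q)` on the fixed module, and its
Gram matrix is read off from `x y' + y x'`. -/

namespace DihedralTwist

/-! ### Comodule algebras over the dual of `H`, seen as algebras with an action of `H`. -/

section Torsor
variable {R H : Type*} [CommRing R] [Ring H] [Bialgebra R H] {B : Type*} [CommRing B] [Algebra R B]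

/-- Evaluation of the second factor of `B ⊗ A` at `h ∈ H`. -/
noncomputable def evalAt (B : Type*) [CommRing B] [Algebra R B] (h : H) :
    B ⊗[R] DualAlg R H →ₗ[R] B :=
  (TensorProduct.rid R B).toLinearMap ∘ₗ (dualPairing R H h).lTensor B

@[simp] theorem evalAt_tmul (h : H) (b : B) (a : DualAlg R H) :
    evalAt B h (b ⊗ₜ a) = a h • b := rfl

/-- Expansion in the dual basis: `t = ∑ t(eᵢ) ⊗ eᵢ*` for a basis `eᵢ` of `H`, so its values on `H`
determine `t`. -/
theorem eq_of_evalAt_eq [Module.Free R H] [Module.Finite R H] {t t' : B ⊗[R] DualAlg R H}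
    (h : ∀ x : H, evalAt B x t = evalAt B x t') : t = t' := by
  let e := Module.Free.chooseBasis R H
  have key : ∀ t : B ⊗[R] DualAlg R H,
      t = ∑ i, evalAt B (e i) t ⊗ₜ[R] WithConv.toConv (e.coord i) := by
    intro t
    induction t with
    | zero => simp
    | add x y hx hy =>
      simp only [map_add, TensorProduct.add_tmul, Finset.sum_add_distrib]
      rw [← hx, ← hy]
    | tmul b a =>
      simp only [evalAt_tmul, TensorProduct.smul_tmul, ← TensorProduct.tmul_sum]
      congr 1
      apply WithConv.ofConv_injective
      refine e.ext fun j => ?_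
      simp [WithConv.ofConv_sum]
  rw [key t, key t']
  simp only [h]

protected theorem tensor_add_mul (x y z : B ⊗[R] DualAlg R H) :
    (x + y) * z = x * z + y * z :=
  (Algebra.TensorProduct.instSemiring (R := R) (A := B) (B := DualAlg R H)).right_distrib _ _ _

protected theorem tensor_mul_add (x y z : B ⊗[R] DualAlg R H) :
    x * (y + z) = x * y + x * z :=
  (Algebra.TensorProduct.instSemiring (R := R) (A := B) (B := DualAlg R H)).left_distrib _ _ _

protected theorem tensor_zero_mul (x : B ⊗[R] DualAlg R H) : 0 * x = 0 :=
  (Algebra.TensorProduct.instSemiring (R := R) (A := B) (B := DualAlg R H)).zero_mul _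

protected theorem tensor_mul_zero (x : B ⊗[R] DualAlg R H) : x * 0 = 0 :=
  (Algebra.TensorProduct.instSemiring (R := R) (A := B) (B := DualAlg R H)).mul_zero _

variable [Coalgebra.IsCocomm R H]

/-- The product of the dual is convolution, that is, the transpose of the comultiplication;
evaluation at a grouplike element is therefore multiplicative. This is what makes `D` act on `B` by
ring maps. -/
theorem evalAt_mul {g : H} (hg : Coalgebra.comul (R := R) g = g ⊗ₜ g)
    (t t' : B ⊗[R] DualAlg R H) : evalAt B g (t * t') = evalAt B g t * evalAt B g t' := by
  induction t with
  | zero => rw [DihedralTwist.tensor_zero_mul, map_zero, zero_mul]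
  | add x y hx hy => rw [DihedralTwist.tensor_add_mul, map_add, map_add, hx, hy, add_mul]
  | tmul b a =>
    induction t' with
    | zero => rw [DihedralTwist.tensor_mul_zero, map_zero, mul_zero]
    | add x y hx hy => rw [DihedralTwist.tensor_mul_add, map_add, map_add, hx, hy, mul_add]
    | tmul b' a' =>
      rw [Algebra.TensorProduct.tmul_mul_tmul, evalAt_tmul, evalAt_tmul, evalAt_tmul,
        LinearMap.convMul_apply, hg, TensorProduct.map_tmul, LinearMap.mul'_apply, smul_mul_smul_comm]

variable {coact : B →ₐ[R] B ⊗[R] DualAlg R H}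

theorem dualAct_eq_evalAt (h : H) (b : B) : dualAct coact h b = evalAt B h (coact b) := rfl

theorem dualAct_mul_apply {g : H} (hg : Coalgebra.comul (R := R) g = g ⊗ₜ g) (b b' : B) :
    dualAct coact g (b * b') = dualAct coact g b * dualAct coact g b' := by
  simp only [dualAct_eq_evalAt, map_mul, evalAt_mul hg]

theorem dualAct_algebraMap {g : H} (hg : Coalgebra.counit (R := R) g = 1) (r : R) :
    dualAct coact g (algebraMap R B r) = algebraMap R B r := by
  rw [dualAct_eq_evalAt, AlgHom.commutes, Algebra.TensorProduct.algebraMap_apply, evalAt_tmul]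
  simp [hg]

/-- On pure tensors both sides are `x (h y)`. This turns the torsor isomorphism into a statement
about the action of `H` on `B`. -/
theorem evalAt_torsorMap (h : H) (t : B ⊗[R] B) :
    evalAt B h (torsorMap R H coact t) = LinearMap.mul' R B ((dualAct coact h).lTensor B t) := by
  induction t with
  | zero => simp
  | add x y hx hy => rw [map_add, map_add, map_add, map_add, hx, hy]
  | tmul x y =>
    have key : ∀ u : B ⊗[R] DualAlg R H,
        evalAt B h ((x ⊗ₜ[R] 1) * u) = x * evalAt B h u := by
      intro u
      induction u with
      | zero => rw [DihedralTwist.tensor_mul_zero, map_zero, mul_zero]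
      | add v w hv hw => rw [DihedralTwist.tensor_mul_add, map_add, map_add, hv, hw, mul_add]
      | tmul b a => simp [Algebra.TensorProduct.tmul_mul_tmul]
    have hxy : torsorMap R H coact (x ⊗ₜ y) = (x ⊗ₜ[R] 1) * coact y :=
      Algebra.TensorProduct.lift_tmul _ _ _ _ _
    rw [hxy, key, LinearMap.lTensor_tmul, LinearMap.mul'_apply, dualAct_eq_evalAt]

variable [Module.Free R H] [Module.Finite R H]

theorem IsComoduleAlgebra.dualAct_one (hB : IsComoduleAlgebra R H coact) (b : B) :
    dualAct coact 1 b = b := LinearMap.congr_fun hB.counit b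

theorem IsComoduleAlgebra.dualAct_mul (hB : IsComoduleAlgebra R H coact) (h h' : H) (b : B) :
    dualAct coact (h * h') b = dualAct coact h (dualAct coact h' b) := by
  -- `F` pairs the two dual factors with `h` and `h'`. Applied to the two sides of coassociativity
  -- it yields the action of `h h'` and the composite of the two actions.
  let F : B ⊗[R] (DualAlg R H ⊗[R] DualAlg R H) →ₗ[R] B :=
    (TensorProduct.rid R B).toLinearMap ∘ₗ (LinearMap.mul' R R ∘ₗ
      TensorProduct.map (dualPairing R H h) (dualPairing R H h')).lTensor B
  have hl : ∀ t : B ⊗[R] DualAlg R H, F ((dualComul R H).lTensor B t) = evalAt B (h * h') t := by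
    intro t
    induction t with
    | zero => simp
    | add x y hx hy => rw [map_add, map_add, map_add, hx, hy]
    | tmul x a => simp [F, dualComul_pairing]
  have hr' : ∀ (u : B ⊗[R] DualAlg R H) (a : DualAlg R H),
      F (TensorProduct.assoc R _ _ _ (u ⊗ₜ a)) = a h' • evalAt B h u := by
    intro u a
    induction u with
    | zero => simp
    | add x y hx hy => rw [TensorProduct.add_tmul, map_add, map_add, map_add, hx, hy, smul_add]
    | tmul x a' => simp [F, dualPairing_apply, smul_smul, mul_comm]
  have hr : ∀ t : B ⊗[R] DualAlg R H,
      F (TensorProduct.assoc R _ _ _ (coact.toLinearMap.rTensor _ t)) =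
        dualAct coact h (evalAt B h' t) := by
    intro t
    induction t with
    | zero => simp
    | add x y hx hy => simp only [map_add, hx, hy]
    | tmul x a => simp [hr', dualAct_eq_evalAt]
  rw [dualAct_eq_evalAt, ← hl, dualAct_eq_evalAt h', ← hr]
  exact (congrArg F (LinearMap.congr_fun hB.coassoc b)).symm

/-- The unit of the dual is the counit of `H`, so the hypothesis says that the coaction of `b` and
`b ⊗ 1` have the same evaluations. -/
theorem IsPHS.mem_range_of_fixed (hB : IsPHS R H coact) {b : B}
    (hb : ∀ h : H, dualAct coact h b = Coalgebra.counit (R := R) h • b) :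
    b ∈ Set.range (algebraMap R B) := by
  rw [← hB.fixed_iff]
  refine eq_of_evalAt_eq fun h => ?_
  rw [← dualAct_eq_evalAt, hb, evalAt_tmul]
  simp

/-- Every linear form on `H` is `h ↦ ∑ xᵢ (h yᵢ)` for some `∑ xᵢ ⊗ yᵢ ∈ B ⊗ B`. -/
theorem IsPHS.exists_dualAct_eq (hB : IsPHS R H coact) (f : H →ₗ[R] R) :
    ∃ t : B ⊗[R] B, ∀ h : H,
      LinearMap.mul' R B ((dualAct coact h).lTensor B t) = algebraMap R B (f h) := by
  -- Only surjectivity of the torsor map is needed: `t` is a preimage of `1 ⊗ f`.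
  obtain ⟨t, ht⟩ := hB.bijective.2 (1 ⊗ₜ WithConv.toConv f)
  refine ⟨t, fun h => ?_⟩
  rw [← evalAt_torsorMap, ht, evalAt_tmul, Algebra.algebraMap_eq_smul_one]

/-- A principal homogeneous space for `A = Hom_R(H, R)` has the same rank as `H`. -/
theorem IsPHS.finrank_eq [IsDomain R] [IsLocalRing R] (hB : IsPHS R H coact) :
    Module.finrank R B = Module.finrank R H := by
  have := hB.finite
  have := hB.flat
  have : Module.Free R B := Module.free_of_flat_of_isLocalRing
  have hBn : Nontrivial B := hB.algebraMap_injective.nontrivial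
  -- Comparing ranks gives `rank(B)² = rank(B) rank(H)`, and `rank(B)` can be cancelled because `B`
  -- is free and nonzero.
  have e : B ⊗[R] B ≃ₗ[R] B ⊗[R] (H →ₗ[R] R) :=
    (LinearEquiv.ofBijective (torsorMap R H coact).toLinearMap hB.bijective).trans
      (LinearEquiv.lTensor B (WithConv.linearEquiv R (H →ₗ[R] R)))
  have h := e.finrank_eq
  rw [Module.finrank_tensorProduct, Module.finrank_tensorProduct, Module.finrank_linearMap,
    Module.finrank_self, mul_one] at h
  exact Nat.eq_of_mul_eq_mul_left (Module.finrank_pos) h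

end Torsor


/-! ### The group elements inside `H`, and reduction from `H` to `D`. -/

section GroupElements
variable (R K : Type*) [CommRing R] [IsDomain R] [Field K] [Algebra R K] [IsFractionRing R K]
  (n : ℕ) [NeZero n] [HasEnoughRootsOfUnity R n]

theorem groupElt_mul (d d' : DihedralGroup n) :
    groupElt R K n (d * d') = groupElt R K n d * groupElt R K n d' :=
  Subtype.ext (by simp [groupElt, MonoidAlgebra.single_mul_single])

theorem groupElt_one : groupElt R K n 1 = 1 := Subtype.ext rfl

theorem groupElt_r (i : ZMod n) :
    groupElt R K n (.r i) = ∑ φ : AddChar (ZMod n) R, φ i • orderGen R K n (φ, false) := by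
  apply Subtype.ext
  simpa [groupElt, orderGen, orderVec] using single_r_eq (R := R) K i

theorem groupElt_sr (i : ZMod n) :
    groupElt R K n (.sr i) = ∑ φ : AddChar (ZMod n) R, φ (-i) • orderGen R K n (φ, true) := by
  apply Subtype.ext
  have h := congrArg (· * tau K n) (single_r_eq (R := R) K (-i))
  simpa [groupElt, orderGen, orderVec, tau, MonoidAlgebra.single_mul_single, Finset.sum_mul]
    using h

/-- Since `φ(i) = α(i) (φ α⁻¹)(i)`, the double sum over `φ` and `α` factors after replacing `φ` by
`φ α⁻¹`. The two values of `s` cover rotations and reflections at once. -/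
theorem comul_sum_orderGen (i : ZMod n) (s : Bool) :
    Coalgebra.comul (R := R) (∑ φ : AddChar (ZMod n) R, φ i • orderGen R K n (φ, s)) =
      (∑ φ : AddChar (ZMod n) R, φ i • orderGen R K n (φ, s)) ⊗ₜ
        ∑ φ : AddChar (ZMod n) R, φ i • orderGen R K n (φ, s) := by
  simp only [map_sum, map_smul, comul_gen, TensorProduct.sum_tmul, TensorProduct.tmul_sum,
    Finset.smul_sum]
  rw [Finset.sum_comm]
  conv_rhs => rw [Finset.sum_comm]
  refine Finset.sum_congr rfl fun α _ => ?_
  refine Fintype.sum_equiv (Equiv.mulRight α⁻¹) _ _ fun φ => ?_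
  have h : α i * α (-i) = 1 := by rw [← AddChar.map_add_eq_mul]; simp
  simp only [Equiv.coe_mulRight, TensorProduct.smul_tmul_smul, AddChar.mul_apply,
    AddChar.inv_apply]
  congr 1
  linear_combination (-φ i) * h

theorem comul_groupElt (d : DihedralGroup n) :
    Coalgebra.comul (R := R) (groupElt R K n d) = groupElt R K n d ⊗ₜ groupElt R K n d := by
  cases d with
  | r i => rw [groupElt_r, comul_sum_orderGen]
  | sr i => rw [groupElt_sr, comul_sum_orderGen]

theorem counit_groupElt (d : DihedralGroup n) :
    Coalgebra.counit (R := R) (groupElt R K n d) = 1 := by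
  apply IsFractionRing.injective R K
  rw [counit_coe]
  simp [groupElt]

/-- Clearing the denominator of `e_φ`; together with the reflection case below this shows `n H ⊂
R[D]`. -/
theorem natCast_smul_orderGen_false (φ : AddChar (ZMod n) R) :
    (n : R) • orderGen R K n (φ, false) = ∑ i, φ i • groupElt R K n (.r (-i)) := by
  have hn := natCast_ne_zero' R K (n := n)
  apply Subtype.ext
  have key : (n : K) • idem R K n φ = ∑ i, algebraMap R K (φ i) •
      MonoidAlgebra.single (DihedralGroup.r (-i)) (1 : K) := by
    simp [idem, Finset.smul_sum, hn, Algebra.algebraMap_eq_smul_one]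
  simpa [orderGen, orderVec, groupElt, Nat.cast_smul_eq_nsmul] using key

theorem natCast_smul_orderGen_true (φ : AddChar (ZMod n) R) :
    (n : R) • orderGen R K n (φ, true) = ∑ i, φ i • groupElt R K n (.sr i) := by
  have hn := natCast_ne_zero' R K (n := n)
  apply Subtype.ext
  have key : (n : K) • (idem R K n φ * tau K n) = ∑ i, algebraMap R K (φ i) •
      MonoidAlgebra.single (DihedralGroup.sr i) (1 : K) := by
    simp [idem, tau, Finset.smul_sum, hn, Finset.sum_mul, MonoidAlgebra.single_mul_single,
      Algebra.algebraMap_eq_smul_one]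
  simpa [orderGen, orderVec, groupElt, Nat.cast_smul_eq_nsmul] using key

variable {R K n}

/-- Linear maps from `H` to a torsion free module are determined by their values on `D`. -/
theorem hom_ext_groupElt {V : Type*} [AddCommGroup V] [Module R V] [Module.IsTorsionFree R V]
    {f g : dihedralOrder R K n →ₗ[R] V} (h : ∀ d, f (groupElt R K n d) = g (groupElt R K n d)) :
    f = g := by
  refine (orderBasis R K n).ext fun p => ?_
  have hn : (n : R) ≠ 0 := natCast_ne_zero
  -- Multiplication by the nonzero `n` is injective on `V` and moves the basis of `H` into the span
  -- of `D`.
  refine (smul_right_injective V hn) ?_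
  obtain ⟨φ, s⟩ := p
  cases s
  · change (n : R) • f _ = (n : R) • g _
    rw [orderBasis_apply, ← map_smul, ← map_smul, natCast_smul_orderGen_false]
    simp only [map_sum, map_smul, h]
  · change (n : R) • f _ = (n : R) • g _
    rw [orderBasis_apply, ← map_smul, ← map_smul, natCast_smul_orderGen_true]
    simp only [map_sum, map_smul, h]

/-- In a torsion free module, an element fixed by `σ` and `τ` is fixed by `H`. -/
theorem fixed_of_fixed {V : Type*} [AddCommGroup V] [Module R V] [Module.IsTorsionFree R V]
    {F : dihedralOrder R K n →ₗ[R] Module.End R V}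
    (hF : ∀ d d' v, F (groupElt R K n (d * d')) v = F (groupElt R K n d) (F (groupElt R K n d') v))
    (hF1 : ∀ v, F (groupElt R K n 1) v = v) {v : V}
    (hσ : F (groupElt R K n (.r 1)) v = v) (hτ : F (groupElt R K n (.sr 0)) v = v)
    (h : dihedralOrder R K n) : F h v = Coalgebra.counit (R := R) h • v := by
  have hr : ∀ k : ℕ, F (groupElt R K n (.r 1 ^ k)) v = v := by
    intro k
    induction k with
    | zero => rw [pow_zero, hF1]
    | succ k ih => rw [pow_succ, hF, hσ, ih]
  have hr' : ∀ i : ZMod n, F (groupElt R K n (.r i)) v = v := fun i => by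
    have := hr i.val
    rwa [DihedralGroup.r_one_pow, ZMod.natCast_zmod_val] at this
  have hd : ∀ d, F (groupElt R K n d) v = v := by
    intro d
    cases d with
    | r i => exact hr' i
    | sr i =>
      have : DihedralGroup.sr i = .sr 0 * .r i := by simp
      rw [this, hF, hr', hτ]
  -- Both sides are linear in the element of `H`, so agreement on `D`, where the counit is 1,
  -- suffices.
  have key : F.flip v = (Coalgebra.counit (R := R)).smulRight v :=
    hom_ext_groupElt fun d => by simp [hd, counit_groupElt]
  exact LinearMap.congr_fun key h

theorem counit_twistIntegral : Coalgebra.counit (R := R) (twistIntegral R K n) =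
    2 * open Classical in (if IsUnit (n : R) then (n : R) else 1) := by
  classical
  simp only [twistIntegral, map_smul, map_add, counit_gen, smul_eq_mul]
  simp only [if_true]
  ring

end GroupElements


/-! ### Structure of `B`: rank, fixed elements, the generator `δ`, the decomposition of `B^C`. -/

section PHS
variable {R K : Type*} [CommRing R] [IsDomain R] [Field K] [Algebra R K] [IsFractionRing R K]
  {n : ℕ} [NeZero n] [HasEnoughRootsOfUnity R n] {B : Type*} [CommRing B] [Algebra R B]
  {coact : B →ₐ[R] B ⊗[R] DualAlg R (dihedralOrder R K n)}

theorem dualAct_groupElt_mul (d : DihedralGroup n) (b b' : B) :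
    dualAct coact (groupElt R K n d) (b * b') =
      dualAct coact (groupElt R K n d) b * dualAct coact (groupElt R K n d) b' :=
  dualAct_mul_apply (comul_groupElt R K n d) b b'

theorem dualAct_groupElt_algebraMap (d : DihedralGroup n) (r : R) :
    dualAct coact (groupElt R K n d) (algebraMap R B r) = algebraMap R B r :=
  dualAct_algebraMap (counit_groupElt R K n d) r

theorem dualAct_groupElt_one' (d : DihedralGroup n) :
    dualAct coact (groupElt R K n d) (1 : B) = 1 := by
  simpa using dualAct_groupElt_algebraMap (coact := coact) d 1

namespace IsPHS

theorem dualAct_groupElt_comp (hB : IsPHS R (dihedralOrder R K n) coact) (d d' : DihedralGroup n)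
    (b : B) : dualAct coact (groupElt R K n (d * d')) b =
      dualAct coact (groupElt R K n d) (dualAct coact (groupElt R K n d') b) := by
  rw [groupElt_mul, hB.toIsComoduleAlgebra.dualAct_mul]

theorem dualAct_groupElt_one (hB : IsPHS R (dihedralOrder R K n) coact) (b : B) :
    dualAct coact (groupElt R K n 1) b = b := by
  rw [groupElt_one, hB.toIsComoduleAlgebra.dualAct_one]

theorem tau_tau (hB : IsPHS R (dihedralOrder R K n) coact) (b : B) :
    dualAct coact (groupElt R K n (.sr 0)) (dualAct coact (groupElt R K n (.sr 0)) b) = b := by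
  rw [← hB.dualAct_groupElt_comp, DihedralGroup.sr_mul_self, hB.dualAct_groupElt_one]

/-- `τ` exchanges the eigenspaces of `σ` for inverse eigenvalues. -/
theorem sigma_tau (hB : IsPHS R (dihedralOrder R K n) coact) {u v : R} (huv : v * u = 1) {b : B}
    (hb : dualAct coact (groupElt R K n (.r 1)) b = u • b) :
    dualAct coact (groupElt R K n (.r 1)) (dualAct coact (groupElt R K n (.sr 0)) b) =
      v • dualAct coact (groupElt R K n (.sr 0)) b := by
  -- `σ⁻¹` acts on `b` by the inverse eigenvalue `v`, and `σ τ = τ σ⁻¹`.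
  have h : dualAct coact (groupElt R K n (.r (-1))) b = v • b := by
    have h1 : dualAct coact (groupElt R K n (.r (-1)))
        (dualAct coact (groupElt R K n (.r 1)) b) = b := by
      rw [← hB.dualAct_groupElt_comp, DihedralGroup.r_mul_r, neg_add_cancel, DihedralGroup.r_zero,
        hB.dualAct_groupElt_one]
    rw [hb, map_smul] at h1
    calc _ = (v * u) • dualAct coact (groupElt R K n (.r (-1))) b := by rw [huv, one_smul]
      _ = v • b := by rw [mul_smul, h1]
  rw [← hB.dualAct_groupElt_comp, show (DihedralGroup.r 1 * .sr 0 : DihedralGroup n) =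
    .sr 0 * .r (-1) by simp, hB.dualAct_groupElt_comp, h, map_smul]

theorem free [IsLocalRing R] (hB : IsPHS R (dihedralOrder R K n) coact) : Module.Free R B := by
  have := hB.finite
  have := hB.flat
  exact Module.free_of_flat_of_isLocalRing

theorem finrank_eq_two_mul [IsLocalRing R] (hB : IsPHS R (dihedralOrder R K n) coact) :
    Module.finrank R B = 2 * n := by
  rw [hB.finrank_eq, Module.finrank_eq_card_basis (orderBasis R K n), Fintype.card_prod, card_char,
    Fintype.card_bool, mul_comm]

theorem mem_range_of_sigma_tau [IsLocalRing R] (hB : IsPHS R (dihedralOrder R K n) coact) {b : B}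
    (hσ : dualAct coact (groupElt R K n (.r 1)) b = b)
    (hτ : dualAct coact (groupElt R K n (.sr 0)) b = b) : b ∈ Set.range (algebraMap R B) := by
  have := hB.free
  exact hB.mem_range_of_fixed fun h =>
    fixed_of_fixed hB.dualAct_groupElt_comp hB.dualAct_groupElt_one hσ hτ h

/-- Elements of `D` act multiplicatively, so the inverse of a fixed unit is fixed too; both lie in
`R`, and so does the relation between them because `R` embeds in `B`. -/
theorem exists_unit_of_sigma_tau [IsLocalRing R] (hB : IsPHS R (dihedralOrder R K n) coact) {b : B}
    (hu : IsUnit b) (hσ : dualAct coact (groupElt R K n (.r 1)) b = b)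
    (hτ : dualAct coact (groupElt R K n (.sr 0)) b = b) : ∃ a : Rˣ, algebraMap R B a = b := by
  obtain ⟨u, rfl⟩ := hu
  have hinv : ∀ d, dualAct coact (groupElt R K n d) (u : B) = u →
      dualAct coact (groupElt R K n d) (↑u⁻¹ : B) = ↑u⁻¹ := fun d hd => by
    have h := dualAct_groupElt_mul (coact := coact) d (u : B) ↑u⁻¹
    rw [Units.mul_inv, dualAct_groupElt_one', hd] at h
    exact (Units.inv_eq_of_mul_eq_one_right h.symm).symm
  obtain ⟨a, ha⟩ := hB.mem_range_of_sigma_tau hσ hτ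
  obtain ⟨a', ha'⟩ := hB.mem_range_of_sigma_tau (hinv _ hσ) (hinv _ hτ)
  have haa : a * a' = 1 := hB.algebraMap_injective (by rw [map_mul, ha, ha']; simp)
  exact ⟨⟨a, a', haa, by rw [mul_comm, haa]⟩, ha⟩

/-- The image of `e_1 - e_1 τ` is contained in the `-1`-eigenspace of `τ` on `B^C`. -/
theorem dualAct_mem_minusPart (hB : IsPHS R (dihedralOrder R K n) coact) (b : B) :
    dualAct coact (orderGen R K n (1, false) - orderGen R K n (1, true)) b ∈
      minusPart K coact := by
  classical
  constructor
  -- It is enough to compute in `H`: left multiplication by `σ` fixes `e_1 - e_1 τ`, and left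
  -- multiplication by `τ` negates it.
  · rw [← hB.toIsComoduleAlgebra.dualAct_mul]
    congr 2
    simp [groupElt_r, mul_sub, Finset.sum_mul, orderGen_mul, charAct]
  · rw [← hB.toIsComoduleAlgebra.dualAct_mul, ← LinearMap.neg_apply, ← map_neg]
    congr 2
    simp [groupElt_sr, mul_sub, Finset.sum_mul, orderGen_mul, charAct]

/-- Put `e = e_1 - e_1 τ`, which maps `B` into `R δ`. A linear form on `H` with value 2 at `e` is
represented by some `∑ xᵢ ⊗ yᵢ` through the torsor isomorphism, so `2 = ∑ xᵢ (e yᵢ)` lies in the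
ideal `B δ`, and 2 is a unit. -/
theorem isUnit_of_span_eq_minusPart (h2 : IsUnit (2 : R))
    (hB : IsPHS R (dihedralOrder R K n) coact) {δ : B}
    (hδ : Submodule.span R {δ} = minusPart K coact) : IsUnit δ := by
  classical
  obtain ⟨f, hf⟩ : ∃ f : dihedralOrder R K n →ₗ[R] R,
      f (orderGen R K n (1, false) - orderGen R K n (1, true)) = 2 := by
    -- The difference of the two coordinates takes the value `1 - (-1) = 2` on `e_1 - e_1 τ`.
    refine ⟨(orderBasis R K n).coord (1, false) - (orderBasis R K n).coord (1, true), ?_⟩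
    rw [← orderBasis_apply, ← orderBasis_apply, map_sub _ (orderBasis R K n (1, false))]
    simp [-orderBasis_apply]
    norm_num
  obtain ⟨t, ht⟩ := hB.exists_dualAct_eq f
  have h := ht (orderGen R K n (1, false) - orderGen R K n (1, true))
  rw [hf] at h
  have hmem : ∀ t : B ⊗[R] B, LinearMap.mul' R B ((dualAct coact
      (orderGen R K n (1, false) - orderGen R K n (1, true))).lTensor B t) ∈ Ideal.span {δ} := by
    intro t
    induction t with
    | zero => simp
    | add x y hx hy => rw [map_add, map_add]; exact add_mem hx hy
    | tmul x y =>
      rw [LinearMap.lTensor_tmul, LinearMap.mul'_apply]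
      refine Ideal.mul_mem_left _ _ ?_
      have hy := hB.dualAct_mem_minusPart y
      rw [← hδ] at hy
      obtain ⟨r, hr⟩ := Submodule.mem_span_singleton.1 hy
      rw [← hr, Algebra.smul_def]
      exact Ideal.mul_mem_left _ _ (Ideal.mem_span_singleton_self δ)
  have h2' := hmem t
  rw [h, Ideal.mem_span_singleton] at h2'
  refine isUnit_of_dvd_unit h2' ?_
  simpa using h2.map (algebraMap R B)

/-- `B^C = R ⊕ R δ`. -/
theorem exists_eq_add_smul [IsLocalRing R] (h2 : IsUnit (2 : R))
    (hB : IsPHS R (dihedralOrder R K n) coact) {δ : B}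
    (hδ : Submodule.span R {δ} = minusPart K coact) {b : B}
    (hσ : dualAct coact (groupElt R K n (.r 1)) b = b) :
    ∃ r s : R, b = algebraMap R B r + s • δ := by
  obtain ⟨u, hu⟩ := h2
  -- With `b' = τ b`, split `2b = (b + b') + (b - b')`: the first summand is fixed by `D`, the
  -- second is in the `-1`-eigenspace.
  set b' := dualAct coact (groupElt R K n (.sr 0)) b with hb'
  have hσ' : dualAct coact (groupElt R K n (.r 1)) b' = b' := by
    simpa using hB.sigma_tau (u := 1) (v := 1) (one_mul 1) (b := b) (by simpa using hσ)
  have hτ' : dualAct coact (groupElt R K n (.sr 0)) b' = b := hB.tau_tau b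
  obtain ⟨r, hr⟩ := hB.mem_range_of_sigma_tau (b := b + b') (by rw [map_add, hσ, hσ'])
    (by rw [map_add, hτ', ← hb', add_comm])
  have hm : b - b' ∈ minusPart K coact :=
    ⟨by rw [map_sub, hσ, hσ'], by rw [map_sub, hτ', ← hb', neg_sub]⟩
  rw [← hδ] at hm
  obtain ⟨s, hs⟩ := Submodule.mem_span_singleton.1 hm
  refine ⟨↑u⁻¹ * r, ↑u⁻¹ * s, ?_⟩
  have h : (2 : R) • b = algebraMap R B r + s • δ := by
    rw [hr, hs, two_smul]; abel
  rw [map_mul, ← Algebra.smul_def, mul_smul, ← smul_add, ← h, smul_smul, ← hu, Units.inv_mul,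
    one_smul]

/-- The automorphism of `B` given by an element of `D`. -/
noncomputable def groupAlgEquiv (hB : IsPHS R (dihedralOrder R K n) coact) (d : DihedralGroup n) :
    B ≃ₐ[R] B :=
  AlgEquiv.ofLinearEquiv
    (LinearEquiv.ofLinearMap (dualAct coact (groupElt R K n d)) (dualAct coact (groupElt R K n d⁻¹))
      (LinearMap.ext fun b => by
        simp [← hB.dualAct_groupElt_comp, hB.dualAct_groupElt_one, -DihedralGroup.inv_r,
          -DihedralGroup.inv_sr])
      (LinearMap.ext fun b => by
        simp [← hB.dualAct_groupElt_comp, hB.dualAct_groupElt_one, -DihedralGroup.inv_r,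
          -DihedralGroup.inv_sr]))
    (dualAct_groupElt_one' d) (dualAct_groupElt_mul d)

end IsPHS
end PHS


/-! ### The module `M` with its action of `D` and its hyperbolic form. -/

section Module
variable {R K : Type*} [CommRing R] [IsDomain R] [Field K] [Algebra R K] [IsFractionRing R K]
  {n : ℕ} [NeZero n] [HasEnoughRootsOfUnity R n]

theorem single_r_mul_idem (i : ZMod n) (χ : AddChar (ZMod n) R) :
    MonoidAlgebra.single (DihedralGroup.r i) (1 : K) * idem R K n χ = χ i • idem R K n χ := by
  classical
  rw [single_r_eq (R := R), Finset.sum_mul]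
  simp [idem_mul_idem]

variable (R K n) in
/-- The basis `e_χ, e_{χ̄} τ` of `M`. -/
noncomputable def moduleBasis (χ : AddChar (ZMod n) R) :
    Module.Basis (Fin 2) R (dihedralModule R K n χ) :=
  Module.Basis.mk (v := ![vecOne R K n χ, vecTwo R K n χ])
    (by
      refine LinearIndependent.of_comp (dihedralModule R K n χ).subtype ?_
      have h := (linearIndependent_orderVec (R := R) K (n := n)).comp
        ![(χ, false), (χ⁻¹, true)] (by
          intro i j hij
          fin_cases i <;> fin_cases j <;> simp_all)
      convert h using 1
      funext i
      fin_cases i <;> simp [vecOne, vecTwo, orderVec])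
    (by
      rintro ⟨x, hx⟩ -
      unfold dihedralModule at hx
      obtain ⟨a, b, rfl⟩ := Submodule.mem_span_pair.1 hx
      refine Submodule.mem_span_range_iff_exists_fun R |>.2 ⟨![a, b], ?_⟩
      apply Subtype.ext
      simp [vecOne, vecTwo])

@[simp] theorem moduleBasis_zero (χ : AddChar (ZMod n) R) :
    moduleBasis R K n χ 0 = vecOne R K n χ := by simp [moduleBasis]

@[simp] theorem moduleBasis_one (χ : AddChar (ZMod n) R) :
    moduleBasis R K n χ 1 = vecTwo R K n χ := by simp [moduleBasis]

theorem moduleAct_r_vecOne (χ : AddChar (ZMod n) R) (i : ZMod n) :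
    moduleAct R K n χ (groupElt R K n (.r i)) (vecOne R K n χ) = χ i • vecOne R K n χ :=
  Subtype.ext (single_r_mul_idem i χ)

theorem moduleAct_r_vecTwo (χ : AddChar (ZMod n) R) (i : ZMod n) :
    moduleAct R K n χ (groupElt R K n (.r i)) (vecTwo R K n χ) = χ (-i) • vecTwo R K n χ := by
  apply Subtype.ext
  change MonoidAlgebra.single (DihedralGroup.r i) (1 : K) * (idem R K n χ⁻¹ * tau K n) =
    χ (-i) • (idem R K n χ⁻¹ * tau K n)
  rw [← mul_assoc, single_r_mul_idem, AddChar.inv_apply, smul_mul_assoc]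

theorem moduleAct_sr_vecOne (χ : AddChar (ZMod n) R) :
    moduleAct R K n χ (groupElt R K n (.sr 0)) (vecOne R K n χ) = vecTwo R K n χ :=
  Subtype.ext (tau_mul_idem K χ)

theorem moduleAct_sr_vecTwo (χ : AddChar (ZMod n) R) :
    moduleAct R K n χ (groupElt R K n (.sr 0)) (vecTwo R K n χ) = vecOne R K n χ := by
  apply Subtype.ext
  change tau K n * (idem R K n χ⁻¹ * tau K n) = idem R K n χ
  rw [← mul_assoc, tau_mul_idem, inv_inv, mul_assoc, tau_mul_tau, mul_one]

theorem moduleAct_mul (χ : AddChar (ZMod n) R) (h h' : dihedralOrder R K n)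
    (w : dihedralModule R K n χ) :
    moduleAct R K n χ (h * h') w = moduleAct R K n χ h (moduleAct R K n χ h' w) :=
  Subtype.ext (mul_assoc (h : MonoidAlgebra K (DihedralGroup n)) _ _)

theorem antipode_idem (χ : AddChar (ZMod n) R) :
    HopfAlgebra.antipode K (idem R K n χ) = idem R K n χ⁻¹ := by
  simp only [idem, map_sum, MonoidAlgebra.antipode_single]
  refine Fintype.sum_equiv (Equiv.neg _) _ _ fun i => ?_
  simp

/-- The element is a combination of reflections, which are their own inverses. -/
theorem antipode_idem_mul_tau (χ : AddChar (ZMod n) R) :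
    HopfAlgebra.antipode K (idem R K n χ * tau K n) = idem R K n χ * tau K n := by
  simp only [idem, tau, Finset.sum_mul, MonoidAlgebra.single_mul_single, map_sum,
    MonoidAlgebra.antipode_single]
  simp

theorem coeff_idem (χ : AddChar (ZMod n) R) : (idem R K n χ).coeff 1 = (n : K)⁻¹ := by
  simpa [orderVec] using orderVec_coeff (R := R) K χ false false

theorem coeff_idem_mul_tau (χ : AddChar (ZMod n) R) : (idem R K n χ * tau K n).coeff 1 = 0 := by
  simpa [orderVec] using orderVec_coeff (R := R) K χ true false

theorem groupForm_apply (x y : MonoidAlgebra K (DihedralGroup n)) : groupForm K n x y =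
    2⁻¹ * (2 * n * (x * tau K n * HopfAlgebra.antipode K y).coeff 1) := rfl

/-- Here `x τ ȳ = e_χ τ e_{χ̄} = e_χ τ` involves only reflections, so its trace vanishes: the line
of `e_χ` is isotropic. -/
theorem moduleForm_one_one (χ : AddChar (ZMod n) R) :
    moduleForm R K n χ (vecOne R K n χ) (vecOne R K n χ) = 0 := by
  classical
  change groupForm K n (idem R K n χ) (idem R K n χ) = 0
  rw [groupForm_apply, antipode_idem, mul_assoc (idem R K n χ), tau_mul_idem, inv_inv,
    ← mul_assoc (idem R K n χ),
    idem_mul_idem, if_pos rfl, coeff_idem_mul_tau, mul_zero, mul_zero]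

theorem moduleForm_two_two (χ : AddChar (ZMod n) R) :
    moduleForm R K n χ (vecTwo R K n χ) (vecTwo R K n χ) = 0 := by
  classical
  change groupForm K n (idem R K n χ⁻¹ * tau K n) (idem R K n χ⁻¹ * tau K n) = 0
  rw [groupForm_apply, antipode_idem_mul_tau, mul_assoc _ (tau K n) (tau K n), tau_mul_tau,
    mul_one, ← mul_assoc (idem R K n χ⁻¹), idem_mul_idem, if_pos rfl, coeff_idem_mul_tau, mul_zero, mul_zero]

/-- Here `x τ ȳ = e_χ τ e_{χ̄} τ = e_χ`, whose coefficient `n⁻¹` at the identity is cancelled by the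
factor `2n / 2`. -/
theorem moduleForm_one_two (h2 : (2 : K) ≠ 0) (χ : AddChar (ZMod n) R) :
    moduleForm R K n χ (vecOne R K n χ) (vecTwo R K n χ) = 1 := by
  classical
  have hn := natCast_ne_zero' R K (n := n)
  change groupForm K n (idem R K n χ) (idem R K n χ⁻¹ * tau K n) = 1
  rw [groupForm_apply, antipode_idem_mul_tau, mul_assoc (idem R K n χ), ← mul_assoc (tau K n),
    tau_mul_idem, inv_inv, mul_assoc (idem R K n χ), tau_mul_tau, mul_one, idem_mul_idem,
    if_pos rfl, coeff_idem]
  field_simp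

theorem moduleForm_two_one (h2 : (2 : K) ≠ 0) (χ : AddChar (ZMod n) R) :
    moduleForm R K n χ (vecTwo R K n χ) (vecOne R K n χ) = 1 := by
  classical
  have hn := natCast_ne_zero' R K (n := n)
  change groupForm K n (idem R K n χ⁻¹ * tau K n) (idem R K n χ) = 1
  rw [groupForm_apply, antipode_idem, mul_assoc _ (tau K n) (tau K n), tau_mul_tau, mul_one,
    idem_mul_idem, if_pos rfl, coeff_idem]
  field_simp

/-- The form `q` on `M` is invariant under `D`. -/
theorem moduleForm_groupElt (h2 : (2 : K) ≠ 0) (χ : AddChar (ZMod n) R) (d : DihedralGroup n)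
    (v w : dihedralModule R K n χ) :
    moduleForm R K n χ (moduleAct R K n χ (groupElt R K n d) v)
      (moduleAct R K n χ (groupElt R K n d) w) = moduleForm R K n χ v w := by
  have of_basis : ∀ d : DihedralGroup n, (∀ i j, moduleForm R K n χ
      (moduleAct R K n χ (groupElt R K n d) (moduleBasis R K n χ i))
      (moduleAct R K n χ (groupElt R K n d) (moduleBasis R K n χ j)) =
      moduleForm R K n χ (moduleBasis R K n χ i) (moduleBasis R K n χ j)) → ∀ v w,
      moduleForm R K n χ (moduleAct R K n χ (groupElt R K n d) v)
        (moduleAct R K n χ (groupElt R K n d) w) = moduleForm R K n χ v w := by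
    intro d h v w
    have key : (moduleForm R K n χ).compl₁₂ (moduleAct R K n χ (groupElt R K n d))
        (moduleAct R K n χ (groupElt R K n d)) = moduleForm R K n χ :=
      (moduleBasis R K n χ).ext fun i => (moduleBasis R K n χ).ext fun j => h i j
    exact LinearMap.congr_fun₂ key v w
  -- Rotations scale the two isotropic lines by inverse factors, and `τ` swaps the two basis
  -- vectors; both preserve a hyperbolic plane.
  have hr : ∀ (i : ZMod n) v w, moduleForm R K n χ (moduleAct R K n χ (groupElt R K n (.r i)) v)
      (moduleAct R K n χ (groupElt R K n (.r i)) w) = moduleForm R K n χ v w := fun i => by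
    have h : χ i * χ (-i) = 1 := by rw [← AddChar.map_add_eq_mul]; simp
    refine of_basis _ fun j k => ?_
    fin_cases j <;> fin_cases k <;>
      simp [moduleAct_r_vecOne, moduleAct_r_vecTwo, moduleForm_one_one, moduleForm_two_two,
        moduleForm_one_two h2, moduleForm_two_one h2, smul_smul, h, mul_comm (χ (-i))]
  have hs : ∀ v w, moduleForm R K n χ (moduleAct R K n χ (groupElt R K n (.sr 0)) v)
      (moduleAct R K n χ (groupElt R K n (.sr 0)) w) = moduleForm R K n χ v w := by
    refine of_basis _ fun j k => ?_
    fin_cases j <;> fin_cases k <;>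
      simp [moduleAct_sr_vecOne, moduleAct_sr_vecTwo, moduleForm_one_one, moduleForm_two_two,
        moduleForm_one_two h2, moduleForm_two_one h2]
  cases d with
  | r i => exact hr i v w
  | sr i =>
    rw [show (DihedralGroup.sr i : DihedralGroup n) = .sr 0 * .r i by simp, groupElt_mul,
      moduleAct_mul, moduleAct_mul, hs, hr]

end Module

/-! ### The lattice `cB` and its trace form. -/

section Lattice
variable {R K B : Type*} [CommRing R] [Field K] [Algebra R K] [CommRing B] [Algebra R B]

variable (R K B) in
/-- `b ↦ c b` as a linear map onto the lattice `c B`. -/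
noncomputable def scaledMap (c : K) : B →ₗ[R] scaledLattice R K B c :=
  (TensorProduct.mk R K B c).rangeRestrict

@[simp] theorem scaledMap_apply (c : K) (b : B) : scaledMap R K B c b = scaledElt K R c b := rfl

theorem scaledMap_surjective (c : K) : Function.Surjective (scaledMap R K B c) :=
  LinearMap.surjective_rangeRestrict _

/-- Flatness embeds `B` into `K ⊗ B`, and `c` is invertible in `K`. -/
theorem scaledMap_injective [IsDomain R] [IsFractionRing R K] [Module.Flat R B] {c : K}
    (hc : c ≠ 0) : Function.Injective (scaledMap R K B c) := by
  intro b b' h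
  have h1 : c ⊗ₜ[R] b = c ⊗ₜ[R] b' := congrArg Subtype.val h
  refine Algebra.TensorProduct.includeRight_injective (R := R) (A := K) (B := B)
    (IsFractionRing.injective R K) ?_
  have h3 := congrArg (c⁻¹ • ·) h1
  simpa [TensorProduct.smul_tmul', hc] using h3

theorem scaledTrace_scaledElt [Module.Free R B] [Module.Finite R B] (c : K) (b b' : B) :
    scaledTrace R K B c (scaledElt K R c b) (scaledElt K R c b') =
      c ^ 2 * algebraMap R K (Algebra.trace R B (b * b')) := by
  change Algebra.trace K (K ⊗[R] B) ((c ⊗ₜ b) * (c ⊗ₜ b')) = _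
  rw [Algebra.TensorProduct.tmul_mul_tmul, show (c * c) ⊗ₜ[R] (b * b') =
    (c ^ 2) • ((1 : K) ⊗ₜ[R] (b * b')) by simp [TensorProduct.smul_tmul', sq], map_smul,
    Algebra.trace_apply, ← Algebra.baseChange_lmul, LinearMap.trace_baseChange, smul_eq_mul,
    Algebra.trace_apply]

end Lattice


/-! ### Coordinates on `cB ⊗ M`, the invariant form `Tr ⊗ q`, and the fixed module. -/

section Twist
variable {R K : Type*} [CommRing R] [IsDomain R] [Field K] [Algebra R K] [IsFractionRing R K]
  {n : ℕ} [NeZero n] [HasEnoughRootsOfUnity R n] {B : Type*} [CommRing B] [Algebra R B]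
  {coact : B →ₐ[R] B ⊗[R] DualAlg R (dihedralOrder R K n)} {χ : AddChar (ZMod n) R} {c : K}

theorem scaledAct_scaledElt (h : dihedralOrder R K n) (b : B) :
    scaledAct K (dualAct coact) c h (scaledElt K R c b) =
      scaledElt K R c (dualAct coact h b) :=
  Subtype.ext (by simp [scaledAct, scaledElt])

theorem twistAct_groupElt_tmul (d : DihedralGroup n) (x : scaledLattice R K B c)
    (w : dihedralModule R K n χ) :
    twistAct K coact χ c (groupElt R K n d) (x ⊗ₜ w) =
      scaledAct K (dualAct coact) c (groupElt R K n d) x ⊗ₜ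
        moduleAct R K n χ (groupElt R K n d) w := by
  simp [twistAct, diagAct, comul_groupElt]

variable (K χ c) in
/-- The element `c x ⊗ e_χ + c y ⊗ e_{χ̄} τ` of `c B ⊗ M`. -/
noncomputable def pairElt (x y : B) : scaledLattice R K B c ⊗[R] dihedralModule R K n χ :=
  scaledElt K R c x ⊗ₜ[R] vecOne R K n χ + scaledElt K R c y ⊗ₜ[R] vecTwo R K n χ

theorem exists_eq_pairElt (z : scaledLattice R K B c ⊗[R] dihedralModule R K n χ) :
    ∃ x y : B, z = pairElt K χ c x y := by
  induction z with
  | zero => exact ⟨0, 0, by simp [pairElt, ← scaledMap_apply]⟩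
  | add z z' hz hz' =>
    obtain ⟨x, y, rfl⟩ := hz
    obtain ⟨x', y', rfl⟩ := hz'
    refine ⟨x + x', y + y', ?_⟩
    simp only [pairElt, ← scaledMap_apply, map_add, TensorProduct.add_tmul]
    abel
  | tmul b w =>
    obtain ⟨b, rfl⟩ := scaledMap_surjective c b
    refine ⟨(moduleBasis R K n χ).repr w 0 • b, (moduleBasis R K n χ).repr w 1 • b, ?_⟩
    conv_lhs => rw [← (moduleBasis R K n χ).sum_repr w, Fin.sum_univ_two, moduleBasis_zero,
      moduleBasis_one, TensorProduct.tmul_add, TensorProduct.tmul_smul, TensorProduct.tmul_smul]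
    simp only [pairElt, ← scaledMap_apply, map_smul, TensorProduct.smul_tmul']

theorem pairElt_inj [Module.Flat R B] (hc : c ≠ 0) {x y x' y' : B} :
    pairElt K χ c x y = pairElt K χ c x' y' ↔ x = x' ∧ y = y' := by
  refine ⟨fun h => ?_, by rintro ⟨rfl, rfl⟩; rfl⟩
  -- Applying a coordinate function of `M` to the second tensor factor recovers `c x` or `c y`.
  have hcoord : ∀ i x y, TensorProduct.rid R _
      (((moduleBasis R K n χ).coord i).lTensor (scaledLattice R K B c) (pairElt K χ c x y)) =
      scaledMap R K B c (if i = 0 then x else y) := by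
    intro i x y
    have h0 : (moduleBasis R K n χ).coord i (vecOne R K n χ) = if i = 0 then 1 else 0 := by
      rw [← moduleBasis_zero, Module.Basis.coord_apply, Module.Basis.repr_self,
        Finsupp.single_apply]
      simp only [eq_comm]
    have h1 : (moduleBasis R K n χ).coord i (vecTwo R K n χ) = if i = 0 then 0 else 1 := by
      rw [← moduleBasis_one, Module.Basis.coord_apply, Module.Basis.repr_self]
      fin_cases i <;> simp
    simp only [pairElt, map_add, LinearMap.lTensor_tmul, h0, h1, TensorProduct.rid_tmul]
    split_ifs <;> simp
  have key : ∀ i : Fin 2, (if i = 0 then x else y) = if i = 0 then x' else y' := fun i =>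
    scaledMap_injective (R := R) hc (by rw [← hcoord i x y, h, hcoord])
  exact ⟨by simpa using key 0, by simpa using key 1⟩

theorem pairElt_add (x y x' y' : B) :
    pairElt K χ c (x + x') (y + y') = pairElt K χ c x y + pairElt K χ c x' y' := by
  simp only [pairElt, ← scaledMap_apply, map_add, TensorProduct.add_tmul]
  abel

theorem pairElt_smul (r : R) (x y : B) :
    pairElt K χ c (r • x) (r • y) = r • pairElt K χ c x y := by
  simp only [pairElt, ← scaledMap_apply, map_smul, smul_add, TensorProduct.smul_tmul']

theorem twistAct_r_pairElt (i : ZMod n) (x y : B) :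
    twistAct K coact χ c (groupElt R K n (.r i)) (pairElt K χ c x y) =
      pairElt K χ c (χ i • dualAct coact (groupElt R K n (.r i)) x)
        (χ (-i) • dualAct coact (groupElt R K n (.r i)) y) := by
  simp only [pairElt, map_add, twistAct_groupElt_tmul, scaledAct_scaledElt, moduleAct_r_vecOne,
    moduleAct_r_vecTwo]
  simp only [← scaledMap_apply, map_smul, TensorProduct.smul_tmul]

theorem twistAct_sr_pairElt (x y : B) :
    twistAct K coact χ c (groupElt R K n (.sr 0)) (pairElt K χ c x y) =
      pairElt K χ c (dualAct coact (groupElt R K n (.sr 0)) y)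
        (dualAct coact (groupElt R K n (.sr 0)) x) := by
  simp only [pairElt, map_add, twistAct_groupElt_tmul, scaledAct_scaledElt, moduleAct_sr_vecOne,
    moduleAct_sr_vecTwo]
  rw [add_comm]

theorem isTorsionFree_tensor [Module.Free R B] (hc : c ≠ 0) :
    Module.IsTorsionFree R (scaledLattice R K B c ⊗[R] dihedralModule R K n χ) := by
  have : Module.Free R (scaledLattice R K B c) := Module.Free.of_equiv
    (LinearEquiv.ofBijective _ ⟨scaledMap_injective hc, scaledMap_surjective c⟩)
  have : Module.Free R (dihedralModule R K n χ) := .of_basis (moduleBasis R K n χ)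
  infer_instance

/-- Only the mixed terms survive because `q` is hyperbolic; the factor `c²` is the scaling of the
lattice. -/
theorem tensorForm_pairElt [Module.Free R B] [Module.Finite R B] (h2 : (2 : K) ≠ 0)
    (x y x' y' : B) :
    tensorForm K (scaledTrace R K B c) (moduleForm R K n χ) (pairElt K χ c x y)
      (pairElt K χ c x' y') = c ^ 2 * algebraMap R K (Algebra.trace R B (x * y' + y * x')) := by
  simp only [pairElt, map_add, LinearMap.add_apply, tensorForm_tmul, scaledTrace_scaledElt,
    moduleForm_one_one, moduleForm_two_two, moduleForm_one_two h2, moduleForm_two_one h2]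
  ring

theorem IsPHS.twistAct_groupElt_comp (hB : IsPHS R (dihedralOrder R K n) coact)
    (d d' : DihedralGroup n) (z : scaledLattice R K B c ⊗[R] dihedralModule R K n χ) :
    twistAct K coact χ c (groupElt R K n (d * d')) z =
      twistAct K coact χ c (groupElt R K n d) (twistAct K coact χ c (groupElt R K n d') z) := by
  induction z with
  | zero => simp
  | add z z' hz hz' => simp only [map_add, hz, hz']
  | tmul b w =>
    obtain ⟨b, rfl⟩ := scaledMap_surjective c b
    simp only [twistAct_groupElt_tmul, scaledMap_apply, scaledAct_scaledElt,
      hB.dualAct_groupElt_comp]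
    rw [groupElt_mul, moduleAct_mul]

theorem IsPHS.twistAct_groupElt_one (hB : IsPHS R (dihedralOrder R K n) coact)
    (z : scaledLattice R K B c ⊗[R] dihedralModule R K n χ) :
    twistAct K coact χ c (groupElt R K n 1) z = z := by
  obtain ⟨x, y, rfl⟩ := exists_eq_pairElt z
  rw [← DihedralGroup.r_zero, twistAct_r_pairElt, DihedralGroup.r_zero]
  simp [hB.dualAct_groupElt_one]

theorem IsPHS.trace_groupElt (hB : IsPHS R (dihedralOrder R K n) coact) (d : DihedralGroup n)
    (b : B) : Algebra.trace R B (dualAct coact (groupElt R K n d) b) = Algebra.trace R B b :=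
  Algebra.trace_eq_of_algEquiv (hB.groupAlgEquiv d) b

/-- The form `Tr ⊗ q` is invariant under `D`. -/
theorem IsPHS.tensorForm_groupElt [IsLocalRing R] (h2 : (2 : K) ≠ 0)
    (hB : IsPHS R (dihedralOrder R K n) coact) (d : DihedralGroup n)
    (z z' : scaledLattice R K B c ⊗[R] dihedralModule R K n χ) :
    tensorForm K (scaledTrace R K B c) (moduleForm R K n χ)
      (twistAct K coact χ c (groupElt R K n d) z) (twistAct K coact χ c (groupElt R K n d) z') =
    tensorForm K (scaledTrace R K B c) (moduleForm R K n χ) z z' := by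
  have := hB.free
  have := hB.finite
  induction z with
  | zero => simp
  | add z₁ z₂ h₁ h₂ => simp only [map_add, LinearMap.add_apply, h₁, h₂]
  | tmul b w =>
    induction z' with
    | zero => simp
    | add z₁ z₂ h₁ h₂ => simp only [map_add, h₁, h₂]
    | tmul b' w' =>
      obtain ⟨b, rfl⟩ := scaledMap_surjective c b
      obtain ⟨b', rfl⟩ := scaledMap_surjective c b'
      simp only [twistAct_groupElt_tmul, tensorForm_tmul, moduleForm_groupElt h2, scaledMap_apply,
        scaledAct_scaledElt, scaledTrace_scaledElt, ← dualAct_groupElt_mul, hB.trace_groupElt]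

/-- Against an element fixed by `H`, the form `Tr ⊗ q` transforms by the counit. -/
theorem IsPHS.tensorForm_act_left [IsLocalRing R] (h2 : (2 : K) ≠ 0)
    (hB : IsPHS R (dihedralOrder R K n) coact) (h : dihedralOrder R K n)
    (z : scaledLattice R K B c ⊗[R] dihedralModule R K n χ)
    (w : twistModule K coact χ c) :
    tensorForm K (scaledTrace R K B c) (moduleForm R K n χ) (twistAct K coact χ c h z) w =
      algebraMap R K (Coalgebra.counit (R := R) h) *
        tensorForm K (scaledTrace R K B c) (moduleForm R K n χ) z w := by
  have hK : Module.IsTorsionFree R K :=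
    Module.isTorsionFree_iff_algebraMap_injective.2 (IsFractionRing.injective R K)
  have key : (tensorForm K (scaledTrace R K B c) (moduleForm R K n χ)).flip w ∘ₗ
      (twistAct K coact χ c).flip z = (Coalgebra.counit (R := R)).smulRight
        (tensorForm K (scaledTrace R K B c) (moduleForm R K n χ) z w) := by
    refine hom_ext_groupElt fun d => ?_
    have hw : twistAct K coact χ c (groupElt R K n d) w = w := by
      rw [w.2, counit_groupElt, one_smul]
    have h := hB.tensorForm_groupElt h2 d z (w : scaledLattice R K B c ⊗[R] _)
    rw [hw] at h
    simpa [counit_groupElt] using h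
  simpa [Algebra.smul_def] using LinearMap.congr_fun key h

theorem IsPHS.tensorForm_act_right [IsLocalRing R] (h2 : (2 : K) ≠ 0)
    (hB : IsPHS R (dihedralOrder R K n) coact) (h : dihedralOrder R K n)
    (z : scaledLattice R K B c ⊗[R] dihedralModule R K n χ)
    (w : twistModule K coact χ c) :
    tensorForm K (scaledTrace R K B c) (moduleForm R K n χ) w (twistAct K coact χ c h z) =
      algebraMap R K (Coalgebra.counit (R := R) h) *
        tensorForm K (scaledTrace R K B c) (moduleForm R K n χ) w z := by
  have := hB.free
  have := hB.finite
  -- `Tr ⊗ q` is symmetric, which reduces the claim to the left-hand version.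
  have symm : ∀ u v : scaledLattice R K B c ⊗[R] dihedralModule R K n χ,
      tensorForm K (scaledTrace R K B c) (moduleForm R K n χ) u v =
        tensorForm K (scaledTrace R K B c) (moduleForm R K n χ) v u := by
    intro u v
    obtain ⟨x, y, rfl⟩ := exists_eq_pairElt u
    obtain ⟨x', y', rfl⟩ := exists_eq_pairElt v
    rw [tensorForm_pairElt h2, tensorForm_pairElt h2]
    congr 3
    ring
  rw [symm, symm _ z, hB.tensorForm_act_left h2]

/-- The fixed module consists of the `c x ⊗ e_χ + c (τ x) ⊗ e_{χ̄} τ` with `σ x = χ̄(σ) x`. -/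
theorem IsPHS.pairElt_mem_twistModule [IsLocalRing R] (hc : c ≠ 0)
    (hB : IsPHS R (dihedralOrder R K n) coact) {x y : B} :
    pairElt K χ c x y ∈ twistModule K coact χ c ↔
      dualAct coact (groupElt R K n (.r 1)) x = χ (-1) • x ∧
        y = dualAct coact (groupElt R K n (.sr 0)) x := by
  have := hB.free
  have := hB.flat
  have hχ : χ (-1) * χ 1 = 1 := by rw [← AddChar.map_add_eq_mul]; simp
  constructor
  · intro h
    have hσ := h (groupElt R K n (.r 1))
    have hτ := h (groupElt R K n (.sr 0))
    change twistAct K coact χ c _ _ = _ at hσ hτ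
    rw [twistAct_r_pairElt, counit_groupElt, one_smul, pairElt_inj hc] at hσ
    rw [twistAct_sr_pairElt, counit_groupElt, one_smul, pairElt_inj hc] at hτ
    refine ⟨?_, hτ.2.symm⟩
    conv_rhs => rw [← hσ.1]
    rw [smul_smul, hχ, one_smul]
  · rintro ⟨hx, rfl⟩ h
    have := isTorsionFree_tensor (R := R) (B := B) (χ := χ) hc
    -- The lattice is torsion free, so only `σ` and `τ` need checking.
    refine fixed_of_fixed (V := scaledLattice R K B c ⊗[R] dihedralModule R K n χ)
      (F := twistAct K coact χ c) hB.twistAct_groupElt_comp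
      hB.twistAct_groupElt_one ?_ ?_ h
    · have hτ := hB.sigma_tau (u := χ (-1)) (v := χ 1) (by rw [mul_comm, hχ]) hx
      rw [twistAct_r_pairElt, hx, hτ, smul_smul, smul_smul, hχ, mul_comm, hχ, one_smul, one_smul]
    · rw [twistAct_sr_pairElt, hB.tau_tau]

end Twist


theorem exists_basis_of_pair {R V : Type*} [CommRing R] [AddCommGroup V] [Module R V]
    {W : Submodule R V} {x y : V} (hx : x ∈ W) (hy : y ∈ W)
    (hli : ∀ r s : R, r • x + s • y = 0 → r = 0 ∧ s = 0)
    (hsp : ∀ w ∈ W, ∃ r s : R, r • x + s • y = w) :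
    ∃ ε : Module.Basis (Fin 2) R W, (ε 0 : V) = x ∧ (ε 1 : V) = y := by
  let v : Fin 2 → W := ![⟨x, hx⟩, ⟨y, hy⟩]
  have hv : LinearIndependent R v :=
    LinearIndependent.pair_iff.2 fun r s h => hli r s (congrArg Subtype.val h)
  have hv' : ⊤ ≤ Submodule.span R (Set.range v) := by
    rintro ⟨w, hw⟩ -
    obtain ⟨r, s, rfl⟩ := hsp w hw
    rw [Submodule.mem_span_range_iff_exists_fun]
    exact ⟨![r, s], Subtype.ext (by simp [v])⟩
  exact ⟨Module.Basis.mk hv hv', by rw [Module.Basis.mk_apply]; rfl,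
    by rw [Module.Basis.mk_apply]; rfl⟩

/-! ### The integral `θ^D` and the basis of the twisted module. -/

section Main
variable {R K : Type*} [CommRing R] [IsDomain R] [IsLocalRing R] [Field K] [Algebra R K]
  [IsFractionRing R K] {n : ℕ} [NeZero n] [HasEnoughRootsOfUnity R n] {B : Type*} [CommRing B]
  [Algebra R B] {coact : B →ₐ[R] B ⊗[R] DualAlg R (dihedralOrder R K n)}
  {χ : AddChar (ZMod n) R} {c : K}

theorem twistScalar_ne_zero (s : R) (hs : ¬ IsUnit (n : R) → s ^ 2 = n) :
    twistScalar R K n s ≠ 0 := by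
  unfold twistScalar
  split_ifs with h
  · exact one_ne_zero
  · refine inv_ne_zero fun h0 => ?_
    have hs0 : s = 0 := IsFractionRing.injective R K (by rw [h0, map_zero])
    exact natCast_ne_zero (R := R) (n := n) (by rw [← hs h, hs0]; simp)

/-- This is the counit of `c² ∑ d`, a sum over `2n` group elements. The right side is also the
factor by which `c² Tr` multiplies elements of `R`, which is why the normalisations of `c` and `θ^D`
match. -/
theorem twistScalar_sq (s : R) (hs : ¬ IsUnit (n : R) → s ^ 2 = n) :
    algebraMap R K (Coalgebra.counit (R := R) (twistIntegral R K n)) =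
      2 * n * twistScalar R K n s ^ 2 := by
  have hn := natCast_ne_zero' R K (n := n)
  rw [counit_twistIntegral]
  unfold twistScalar
  split_ifs with h
  · rw [map_mul, map_ofNat, map_natCast, one_pow, mul_one]
  · have hs' : algebraMap R K s ^ 2 = n := by rw [← map_pow, hs h, map_natCast]
    rw [inv_pow, hs', mul_assoc, mul_inv_cancel₀ hn, map_mul, map_ofNat, map_one]

/-- The value is `2n` when `n` is a unit and 2 otherwise. Invertibility makes `θ^D` surjective onto
the fixed module. -/
theorem isUnit_counit_twistIntegral (h2 : IsUnit (2 : R)) :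
    IsUnit (Coalgebra.counit (R := R) (twistIntegral R K n)) := by
  rw [counit_twistIntegral]
  refine h2.mul ?_
  split_ifs with h
  · exact h
  · exact isUnit_one

namespace IsPHS

/-- The `χ̄`-eigenspace of `σ` on `B` is `B^C α^τ` because `α^τ` is a unit in it, and `B^C = R ⊕ R
δ`. The second coordinate is forced to be `τ` of the first, which produces the sign in `-(δ α)`. -/
theorem exists_basis_twistModule (h2 : IsUnit (2 : R)) (hc : c ≠ 0)
    (hB : IsPHS R (dihedralOrder R K n) coact) {δ : B}
    (hδ : Submodule.span R {δ} = minusPart K coact) {α : B} (hα_unit : IsUnit α)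
    (hα : dualAct coact (groupElt R K n (.r 1)) α = χ 1 • α) :
    ∃ ε : Module.Basis (Fin 2) R (twistModule K coact χ c),
      (ε 0 : scaledLattice R K B c ⊗[R] dihedralModule R K n χ) =
        pairElt K χ c (dualAct coact (groupElt R K n (.sr 0)) α) α ∧
      (ε 1 : scaledLattice R K B c ⊗[R] dihedralModule R K n χ) =
        pairElt K χ c (δ * dualAct coact (groupElt R K n (.sr 0)) α) (-(δ * α)) := by
  have := hB.flat
  have hχ : χ (-1) * χ 1 = 1 := by rw [← AddChar.map_add_eq_mul]; simp
  have hδm : δ ∈ minusPart K coact := hδ ▸ Submodule.mem_span_singleton_self δ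
  have hδu := hB.isUnit_of_span_eq_minusPart h2 hδ
  set β := dualAct coact (groupElt R K n (.sr 0)) α with hβ
  have hβσ : dualAct coact (groupElt R K n (.r 1)) β = χ (-1) • β := hB.sigma_tau hχ hα
  have hβτ : dualAct coact (groupElt R K n (.sr 0)) β = α := hB.tau_tau α
  have hβu : IsUnit β := hα_unit.map (hB.groupAlgEquiv (.sr 0))
  have h0 : pairElt K χ c β α ∈ twistModule K coact χ c :=
    (hB.pairElt_mem_twistModule hc).2 ⟨hβσ, hβτ.symm⟩
  have h1 : pairElt K χ c (δ * β) (-(δ * α)) ∈ twistModule K coact χ c :=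
    (hB.pairElt_mem_twistModule hc).2
      ⟨by rw [dualAct_groupElt_mul, hβσ, hδm.1, mul_smul_comm],
        by rw [dualAct_groupElt_mul, hβτ, hδm.2, neg_mul]⟩
  have comb : ∀ r s : R, r • pairElt K χ c β α + s • pairElt K χ c (δ * β) (-(δ * α)) =
      pairElt K χ c ((algebraMap R B r + s • δ) * β) ((algebraMap R B r - s • δ) * α) := by
    intro r s
    rw [← pairElt_smul, ← pairElt_smul, ← pairElt_add]
    congr 1
    · rw [add_mul, Algebra.smul_def, smul_mul_assoc]
    · rw [sub_mul, Algebra.smul_def, smul_mul_assoc, smul_neg, sub_eq_add_neg]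
  refine exists_basis_of_pair (V := scaledLattice R K B c ⊗[R] dihedralModule R K n χ) h0 h1 ?_ ?_
  -- Cancelling the units `α^τ` and `α` leaves `r + s δ = 0` and `r - s δ = 0`; adding them kills
  -- `r`, and then `δ` being a unit kills `s`.
  · intro r s h
    rw [comb, show (0 : scaledLattice R K B c ⊗[R] dihedralModule R K n χ) = pairElt K χ c 0 0 by
      simp [pairElt, ← scaledMap_apply], pairElt_inj hc, hβu.mul_left_eq_zero,
      hα_unit.mul_left_eq_zero] at h
    obtain ⟨u, hu⟩ := h2
    have hr : r = 0 := by
      refine hB.algebraMap_injective ?_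
      have h3 : algebraMap R B (2 * r) = 0 := by
        rw [map_mul, map_ofNat]
        linear_combination h.1 + h.2
      have h4 : 2 * r = 0 := hB.algebraMap_injective (by rw [h3, map_zero])
      rw [← hu, Units.mul_right_eq_zero] at h4
      rw [h4]
    refine ⟨hr, hB.algebraMap_injective ?_⟩
    have h3 := h.1
    rw [hr, map_zero, zero_add, Algebra.smul_def, hδu.mul_left_eq_zero] at h3
    rw [h3, map_zero]
  · intro z hz
    obtain ⟨x, y, rfl⟩ := exists_eq_pairElt z
    obtain ⟨hx, rfl⟩ := (hB.pairElt_mem_twistModule hc).1 hz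
    obtain ⟨u, hu⟩ := hβu
    -- Dividing by `α^τ`, which has the same eigenvalue, leaves an element of `B^C`.
    obtain ⟨x, rfl⟩ : ∃ b, x = b * β := ⟨x * ↑u⁻¹, by rw [← hu]; simp⟩
    have hσ : dualAct coact (groupElt R K n (.r 1)) x = x := by
      rw [dualAct_groupElt_mul, hβσ, mul_smul_comm] at hx
      have h3 := congrArg (χ 1 • ·) hx
      simp only [smul_smul, mul_comm (χ 1), hχ, one_smul, ← hu] at h3
      exact u.isUnit.mul_left_injective h3
    obtain ⟨r, s, rfl⟩ := hB.exists_eq_add_smul h2 hδ hσ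
    refine ⟨r, s, ?_⟩
    rw [comb]
    congr 1
    rw [dualAct_groupElt_mul, hβτ, map_add, map_smul, hδm.2, dualAct_groupElt_algebraMap,
      smul_neg, sub_eq_add_neg]

end IsPHS
end Main
end DihedralTwist

/-! ### The theorem. -/

theorem proposition5p8
    (p : ℕ) [Fact p.Prime] (hp : p ≠ 2)
    {R : Type*} [CommRing R] [IsDomain R] [IsRegularLocalRing R]
    [Algebra ℤ_[p] R] [Algebra.FiniteType ℤ_[p] R]
    {K : Type*} [Field K] [Algebra R K] [IsFractionRing R K]
    {n : ℕ} [NeZero n] (hn : 2 < n) [HasEnoughRootsOfUnity R n]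
    (s : R) (hs : ¬ IsUnit (n : R) → s ^ 2 = n)
    (c : K) (hc : c = twistScalar R K n s)
    {B : Type*} [CommRing B] [Algebra R B]
    (coact : B →ₐ[R] B ⊗[R] DualAlg R (dihedralOrder R K n))
    (hB : IsPHS R (dihedralOrder R K n) coact)
    (δ : B) (hδ : Submodule.span R {δ} = minusPart K coact)
    (χ : AddChar (ZMod n) R) (hχ : 2 < orderOf χ)
    (α : B) (hα_unit : IsUnit α)
    (hα : dualAct coact (groupElt R K n (DihedralGroup.r 1)) α = χ 1 • α)
    (ατ : B) (hατ : ατ = dualAct coact (groupElt R K n (DihedralGroup.sr 0)) α) :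
    ∃ a d : Rˣ, algebraMap R B a = α * ατ ∧ algebraMap R B d = δ ^ 2 ∧
      ∃ (ε : Module.Basis (Fin 2) R (twistModule K coact χ c))
        (β : LinearMap.BilinForm R (twistModule K coact χ c)),
        (ε 0 : scaledLattice R K B c ⊗[R] dihedralModule R K n χ) =
          scaledElt K R c ατ ⊗ₜ[R] vecOne R K n χ + scaledElt K R c α ⊗ₜ[R] vecTwo R K n χ ∧
        (ε 1 : scaledLattice R K B c ⊗[R] dihedralModule R K n χ) =
          scaledElt K R c (δ * ατ) ⊗ₜ[R] vecOne R K n χ -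
            scaledElt K R c (δ * α) ⊗ₜ[R] vecTwo R K n χ ∧
        IsTwistedForm K coact χ c (twistIntegral R K n) β ∧
        β (ε 0) (ε 0) = 2 * a ∧ β (ε 1) (ε 1) = -2 * a * d ∧ β (ε 0) (ε 1) = 0 := by
  -- As `p` is odd, 2 is a unit of the `p`-adic integers, hence of `R`.
  have h2 : IsUnit (2 : R) := by
    have h : IsUnit (2 : ℤ_[p]) := by
      have h := (PadicInt.norm_natCast_eq_one_iff (p := p) (n := 2)).2
        ((Nat.coprime_primes Fact.out Nat.prime_two).2 hp)
      rwa [← PadicInt.isUnit_iff] at h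
    have h' := h.map (algebraMap ℤ_[p] R)
    rwa [map_ofNat] at h'
  have h2K : (2 : K) ≠ 0 := by
    have := (h2.map (algebraMap R K)).ne_zero
    rwa [map_ofNat] at this
  subst hατ
  have hc0 : c ≠ 0 := hc ▸ twistScalar_ne_zero s hs
  have := hB.free
  have := hB.finite
  have hχ' : χ (-1) * χ 1 = 1 := by rw [← AddChar.map_add_eq_mul]; simp
  have hδm : δ ∈ minusPart K coact := hδ ▸ Submodule.mem_span_singleton_self δ
  set ατ := dualAct coact (groupElt R K n (.sr 0)) α with hατ
  have hτσ : dualAct coact (groupElt R K n (.r 1)) ατ = χ (-1) • ατ := hB.sigma_tau hχ' hα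
  have hττ : dualAct coact (groupElt R K n (.sr 0)) ατ = α := hB.tau_tau α
  have hτu : IsUnit ατ := hα_unit.map (hB.groupAlgEquiv (.sr 0))
  -- `σ` scales the two factors by inverse values and `τ` exchanges them, so the product is fixed.
  obtain ⟨a, ha⟩ := hB.exists_unit_of_sigma_tau (hα_unit.mul hτu)
    (by rw [dualAct_groupElt_mul, hα, hτσ, smul_mul_smul_comm, mul_comm (χ 1), hχ', one_smul])
    (by rw [dualAct_groupElt_mul, hττ, ← hατ, mul_comm])
  obtain ⟨d, hd⟩ := hB.exists_unit_of_sigma_tau ((hB.isUnit_of_span_eq_minusPart h2 hδ).pow 2)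
    (by rw [sq, dualAct_groupElt_mul, hδm.1]) (by rw [sq, dualAct_groupElt_mul, hδm.2, neg_mul_neg])
  obtain ⟨ε, hε0, hε1⟩ := hB.exists_basis_twistModule h2 hc0 hδ hα_unit hα
  rw [← hατ] at hε0 hε1
  have htr : ∀ r : R, algebraMap R K (Algebra.trace R B (algebraMap R B r)) =
      2 * n * algebraMap R K r := fun r => by
    rw [Algebra.trace_algebraMap, hB.finrank_eq_two_mul, nsmul_eq_mul, map_mul, map_natCast,
      Nat.cast_mul, Nat.cast_ofNat]
  have hθ := twistScalar_sq (K := K) (n := n) s hs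
  rw [← hc] at hθ
  set Q := tensorForm K (scaledTrace R K B c) (moduleForm R K n χ) with hQ
  set N := Coalgebra.counit (R := R) (twistIntegral R K n) with hN
  have hNu : IsUnit N := isUnit_counit_twistIntegral h2
  have hNK : algebraMap R K N ≠ 0 := (hNu.map (algebraMap R K)).ne_zero
  -- The trace of `r ∈ R` is `2 n r`, so the value is `2 n c² r = N r`.
  have hQ' : ∀ (x y x' y' : B) (r : R), x * y' + y * x' = algebraMap R B r →
      Q (pairElt K χ c x y) (pairElt K χ c x' y') = algebraMap R K N * algebraMap R K r := by
    intro x y x' y' r h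
    rw [hQ, tensorForm_pairElt h2K, h, htr, hθ]
    ring
  -- The form is prescribed by its Gram matrix; the identity `N β = Q` below then shows that it is
  -- the induced one.
  let β : LinearMap.BilinForm R (twistModule K coact χ c) :=
    Matrix.toBilin ε !![2 * (a : R), 0; 0, -2 * a * d]
  have hβ : ∀ i j, β (ε i) (ε j) = !![2 * (a : R), 0; 0, -2 * a * d] i j := fun i j => by
    rw [← LinearMap.BilinForm.toMatrix_apply ε, LinearMap.BilinForm.toMatrix_toBilin]
  have hβQ : ∀ x y : twistModule K coact χ c, algebraMap R K N * algebraMap R K (β x y) = Q x y := by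
    have key : LinearMap.compr₂ β (LinearMap.mulLeft R (algebraMap R K N) ∘ₗ
        Algebra.linearMap R K) =
        Q.compl₁₂ (twistModule K coact χ c).subtype (twistModule K coact χ c).subtype := by
      refine ε.ext fun i => ε.ext fun j => ?_
      change algebraMap R K N * algebraMap R K (β (ε i) (ε j)) = Q (ε i) (ε j)
      rw [hβ]
      fin_cases i <;> fin_cases j
      · change algebraMap R K N * algebraMap R K (2 * a) = Q (ε 0) (ε 0)
        rw [hε0]
        exact (hQ' _ _ _ _ _ (by rw [map_mul, map_ofNat, ha]; ring)).symm
      · change algebraMap R K N * algebraMap R K 0 = Q (ε 0) (ε 1)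
        rw [hε0, hε1]
        exact (hQ' _ _ _ _ _ (by rw [map_zero]; ring)).symm
      · change algebraMap R K N * algebraMap R K 0 = Q (ε 1) (ε 0)
        rw [hε0, hε1]
        exact (hQ' _ _ _ _ _ (by rw [map_zero]; ring)).symm
      · change algebraMap R K N * algebraMap R K (-2 * a * d) = Q (ε 1) (ε 1)
        rw [hε1]
        exact (hQ' _ _ _ _ _ (by
          rw [map_mul, map_mul, map_neg, map_ofNat, ha, hd]; ring)).symm
    exact fun x y => LinearMap.congr_fun₂ key x y
  refine ⟨a, d, ha, hd, ε, β, hε0, ?_, ⟨?_, ?_, ?_⟩, by simp [hβ], by simp [hβ], by simp [hβ]⟩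
  · rw [hε1, pairElt, ← scaledMap_apply, ← scaledMap_apply, ← scaledMap_apply, map_neg,
      TensorProduct.neg_tmul, sub_eq_add_neg]
  · intro x
    obtain ⟨u, hu⟩ := hNu
    -- On fixed elements `θ^D` acts as the unit `N`, so `N⁻¹ x` is a preimage.
    refine ⟨(↑u⁻¹ : R) • x, ?_⟩
    rw [map_smul, x.2, ← hN, ← hu, smul_smul, Units.inv_mul, one_smul]
  · rintro x y m hm
    have h := hβQ x y
    rw [← hm] at h
    -- `N β(θ^D m, y) = Q(θ^D m, y) = N Q(m, y)`, and `N` cancels in `K`.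
    exact mul_left_cancel₀ hNK
      (h.trans (hB.tensorForm_act_left h2K (twistIntegral R K n) m y))
  · rintro x y m hm
    have h := hβQ x y
    rw [← hm] at h
    exact mul_left_cancel₀ hNK
      (h.trans (hB.tensorForm_act_right h2K (twistIntegral R K n) m x))
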